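/- Let $\mathbb{F}_q$ be a finite field with $q$ elements, $C$ a smooth projective geometrically irreducible curve over $\mathbb{F}_q$, $\infty\in C(\mathbb{F}_q)$ a rational point and $A=\Gamma(C\setminus\{\infty\},\mathcal{O}_C)$. Let $L$ be a field extension of $\mathbb{F}_q$ and $c^*:A\to L$ a homomorphism of $\mathbb{F}_q$-algebras. Put $A_L=A\otimes_{\mathbb{F}_q}L$, let $\sigma$ denote the endomorphism $a\otimes b\mapsto a\otimes b^q$ of $A_L$ and the endomorphism of $C_L=C\times_{\mathbb{F}_q}L$ that it comes from, write $\sigma^*M=M\otimes_{A_L,\sigma}A_L$, and let $J\subset A_L$ be the ideal generated by the elements $a\otimes 1-1\otimes c^*(a)$, $a\in A$. A *pure Anderson motive* $\underline{M}=(M,\tau)$ of rank $r\ge 0$, dimension $d\ge 0$ and characteristic $c^*$ over $L$ consists of a locally free $A_L$-module $M$ of rank $r$ and an injective $A_L$-homomorphism $\tau:\sigma^*M\to M$ such that $\operatorname{coker}\tau$ is an $L$-vector space of dimension $d$ annihilated by $J^d$, and such that $M$ extends to a locally free sheaf $\mathcal{M}$ of rank $r$ on $C_L$ for which, for some positive integers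 $k,l$, the map $\tau^l=\tau\circ\sigma^*\tau\circ\dots\circ(\sigma^{*})^{l-1}\tau$ induces an isomorphism of stalks $((\sigma^*)^l\mathcal{M})_\infty\to\mathcal{M}(k\cdot\infty)_\infty$. A morphism $f:(M,\tau)\to(M',\tau')$ of pure Anderson motives of the same characteristic is an $A_L$-homomorphism $f:M\to M'$ with $f\circ\tau=\tau'\circ\sigma^*f$. It is an *isogeny* if it is injective with torsion cokernel, and a *separable isogeny* if moreover the homomorphism $\sigma^*\operatorname{coker}f\to\operatorname{coker}f$ induced by $\tau'$ is an isomorphism. **Theorem.** 1. If $L$ is finite, then the relation "there is a separable isogeny $\underline{M}\to\underline{M}'$" on the pure Anderson motives of characteristic $c^*$ over $L$ is an equivalence relation; in particular it is symmetric. 2. This fails over infinite fields: for every finite field $\mathbb{F}_q$ let $C=\mathbb{P}^1_{\mathbb{F}_q}$ with its usual point $\infty$, $A=\mathbb{F}_q[t]$, $L=\mathbb{F}_q(\gamma)$ with $\gamma$ transcendental over $\mathbb{F}_q$, and $c^*:A\to L$, $t\mapsto 0$. Then there are pure Anderson motives $\underline{M}'$, $\underline{M}$ of characteristic $c^*$ over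 $L$ such that there is a separable isogeny $\underline{M}'\to\underline{M}$ but no separable isogeny $\underline{M}\to\underline{M}'$. -/

import Mathlib

open scoped TensorProduct

universe u

noncomputable section

/-! ## Pull-back of modules along a ring endomorphism -/

section Pullback

variable {R : Type*} [CommRing R] (σ : R →+* R)

/-- The ring `R`, considered as an `R`-algebra through the endomorphism `σ`. -/
def Twisted (_σ : R →+* R) : Type _ := R

instance : CommRing (Twisted σ) := inferInstanceAs (CommRing R)

instance : Algebra R (Twisted σ) := RingHom.toAlgebra (S := Twisted σ) σ

/-- The identity map, from `R` to the ring underlying `Twisted σ`. -/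
def Twisted.of : R →+* Twisted σ := RingHom.id R

variable (M : Type*) [AddCommGroup M] [Module R M]

/-- `σ^* M`, the base change of the `R`-module `M` along `σ : R → R`. -/
def Pullback : Type _ := Twisted σ ⊗[R] M

instance : AddCommGroup (Pullback σ M) := inferInstanceAs (AddCommGroup (Twisted σ ⊗[R] M))

/-- `R` acts on `σ^* M` through the left factor: `s • (a ⊗ m) = (s * a) ⊗ m`. -/
instance : Module R (Pullback σ M) :=
  letI : Module (Twisted σ) (Pullback σ M) :=
    inferInstanceAs (Module (Twisted σ) (Twisted σ ⊗[R] M))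
  Module.compHom (Pullback σ M) (Twisted.of σ)

variable {M}

/-- The pure tensor `a ⊗ m` in `σ^* M`. -/
def Pullback.tmul (a : R) (m : M) : Pullback σ M := (Twisted.of σ a) ⊗ₜ[R] m

theorem Pullback.smul_tmul (s a : R) (m : M) :
    s • Pullback.tmul σ a m = Pullback.tmul σ (s * a) m := rfl

theorem Pullback.tmul_smul (a r : R) (m : M) :
    Pullback.tmul σ a (r • m) = Pullback.tmul σ (σ r * a) m :=
  (TensorProduct.smul_tmul r (Twisted.of σ a) m).symm

theorem Pullback.induction {p : Pullback σ M → Prop} (h0 : p 0)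
    (ht : ∀ a m, p (Pullback.tmul σ a m)) (ha : ∀ x y, p x → p y → p (x + y))
    (x : Pullback σ M) : p x :=
  TensorProduct.induction_on (motive := p) x h0 ht ha

/-- The canonical `σ`-semilinear map `m ↦ 1 ⊗ m`. -/
def Pullback.mk : M →ₛₗ[σ] Pullback σ M where
  toFun m := Pullback.tmul σ 1 m
  map_add' m n := TensorProduct.tmul_add _ m n
  map_smul' r m := by
    rw [Pullback.tmul_smul, Pullback.smul_tmul]

variable {N : Type*} [AddCommGroup N] [Module R N]

variable {σ}

/-- The additive map `σ^* M → N`, `a ⊗ m ↦ a • φ m`. -/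
def Pullback.liftAux (φ : M →ₛₗ[σ] N) : Pullback σ M →+ N :=
  TensorProduct.liftAddHom (R := R) (M := Twisted σ) (N := M)
    { toFun := fun a : R =>
        { toFun := fun m => a • φ m
          map_zero' := by simp
          map_add' := by simp }
      map_zero' := by ext m; exact zero_smul R (φ m)
      map_add' := fun a b => by ext m; exact add_smul (R := R) a b (φ m) }
    (by
      intro r a m
      change (id (σ r * (show R from a)) : R) • φ m = (show R from a) • φ (r • m)
      rw [map_smulₛₗ, smul_smul, mul_comm]; rfl)

/-- The `R`-linear map `σ^* M → N`, `a ⊗ m ↦ a • φ m`, that corresponds to a `σ`-semilinear map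
`φ : M → N`. -/
def Pullback.lift (φ : M →ₛₗ[σ] N) : Pullback σ M →ₗ[R] N where
  toFun := Pullback.liftAux φ
  map_add' := map_add _
  map_smul' s x := by
    induction x using Pullback.induction with
    | h0 => rw [smul_zero, map_zero, smul_zero]
    | ht a m => exact mul_smul s a (φ m)
    | ha x y hx hy => rw [smul_add, map_add, map_add, smul_add, hx, hy]

theorem Pullback.lift_tmul (φ : M →ₛₗ[σ] N) (a : R) (m : M) :
    Pullback.lift φ (Pullback.tmul σ a m) = a • φ m := rfl

/-- `σ^* f : σ^* M → σ^* N`, `a ⊗ m ↦ a ⊗ f m`. -/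
def Pullback.map (σ : R →+* R) (f : M →ₗ[R] N) : Pullback σ M →ₗ[R] Pullback σ N :=
  Pullback.lift ((Pullback.mk σ).comp f)

/-- The `l`-th iterate of a `σ`-semilinear endomorphism, as a `σ^l`-semilinear map. -/
def semilinearIterate (φ : M →ₛₗ[σ] M) (l : ℕ) : M →ₛₗ[σ ^ l] M where
  toFun := φ^[l]
  map_add' := by
    induction l with
    | zero => intro x y; rfl
    | succ l ih => intro x y; simp [Function.iterate_succ_apply', ih]
  map_smul' := by
    induction l with
    | zero => intro r x; rfl
    | succ l ih =>
      intro r x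
      rw [Function.iterate_succ_apply', ih, map_smulₛₗ, Function.iterate_succ_apply', pow_succ']
      rfl

/-- The `R`-linear map `(σ^l)^* N → M` induced by the `l`-th iterate of a `σ`-semilinear
endomorphism `φ` of `M`, for a submodule `N` of `M`. -/
def iterateOn (φ : M →ₛₗ[σ] M) (N : Submodule R M) (l : ℕ) : Pullback (σ ^ l) N →ₗ[R] M :=
  Pullback.lift ((semilinearIterate φ l).comp N.subtype)

/-- The extension of a `σ`-semilinear endomorphism `φ` of `M` to the base change `S ⊗ M` along
`R → S`, where `ρ` is an endomorphism of `S` that extends `σ`: `s ⊗ m ↦ ρ s ⊗ φ m`. -/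
def semilinearBaseChange {S : Type*} [CommRing S] [Algebra R S] (ρ : S →+* S)
    (h : ∀ r : R, ρ (algebraMap R S r) = algebraMap R S (σ r)) (φ : M →ₛₗ[σ] M) :
    (S ⊗[R] M) →ₛₗ[ρ] (S ⊗[R] M) where
  toFun := TensorProduct.liftAddHom (R := R)
    { toFun := fun s =>
        { toFun := fun m => ρ s ⊗ₜ[R] φ m
          map_zero' := by simp
          map_add' := by intro x y; simp [TensorProduct.tmul_add] }
      map_zero' := by ext m; simp
      map_add' := fun a b => by ext m; simp [TensorProduct.add_tmul] }
    (by
      intro r s m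
      change ρ (r • s) ⊗ₜ[R] φ m = ρ s ⊗ₜ[R] φ (r • m)
      rw [map_smulₛₗ φ, ← TensorProduct.smul_tmul, Algebra.smul_def, Algebra.smul_def, map_mul, h])
  map_add' := map_add _
  map_smul' s x := by
    induction x using TensorProduct.induction_on with
    | zero => simp
    | tmul f m =>
      change ρ (s * f) ⊗ₜ[R] φ m = (ρ s * ρ f) ⊗ₜ[R] φ m
      rw [map_mul]
    | add x y hx hy => rw [smul_add, map_add, map_add, smul_add, hx, hy]

theorem semilinearBaseChange_tmul {S : Type*} [CommRing S] [Algebra R S] (ρ : S →+* S)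
    (h : ∀ r : R, ρ (algebraMap R S r) = algebraMap R S (σ r)) (φ : M →ₛₗ[σ] M) (s : S) (m : M) :
    semilinearBaseChange ρ h φ (s ⊗ₜ[R] m) = ρ s ⊗ₜ[R] φ m := rfl

end Pullback

/-! ## Curves over a finite field with a rational point

A smooth projective geometrically irreducible curve `C` over the (perfect) field `Fq` is given by
its function field `Q`. The closed points of `C` are the places of `Q`, that is, the nontrivial
valuation rings of `Q` that contain `Fq`; the valuation ring of a closed point is the local ring
of `C` there. -/

/-- `Q` is the function field of a smooth projective geometrically irreducible curve over the
finite field `Fq`: it is finitely generated of transcendence degree one over `Fq`, and `Fq` is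
algebraically closed in `Q`. -/
structure IsCurveFunctionField (Fq Q : Type*) [Field Fq] [Field Q] [Algebra Fq Q] : Prop where
  fg : (⊤ : IntermediateField Fq Q).FG
  trdeg_eq_one : Algebra.trdeg Fq Q = 1
  algebraic_mem : ∀ x : Q, IsAlgebraic Fq x → x ∈ (algebraMap Fq Q).range

/-- The valuation ring `v` of `Q` is the local ring of a closed point of the curve. -/
def IsPlace (Fq : Type*) {Q : Type*} [Field Fq] [Field Q] [Algebra Fq Q]
    (v : ValuationSubring Q) : Prop :=
  v ≠ ⊤ ∧ ∀ a : Fq, algebraMap Fq Q a ∈ v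

/-- An `Fq`-rational point of the curve: a closed point with residue field `Fq`. -/
structure RationalPoint (Fq Q : Type*) [Field Fq] [Field Q] [Algebra Fq Q] where
  /-- The local ring of the curve at the point. -/
  valuationRing : ValuationSubring Q
  isPlace : IsPlace Fq valuationRing
  residue : ∀ x ∈ valuationRing, ∃ a : Fq, valuationRing.valuation (x - algebraMap Fq Q a) < 1

section Curve

variable {Fq Q : Type u} [Field Fq] [Fintype Fq] [Field Q] [Algebra Fq Q]

/-- The ring `A = Γ(C ∖ {∞}, 𝒪_C)` of the functions that are regular at every closed point other
than `∞`. -/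
def RationalPoint.affineRing (P : RationalPoint Fq Q) : Subalgebra Fq Q where
  carrier := {x | ∀ v : ValuationSubring Q, IsPlace Fq v → v ≠ P.valuationRing → x ∈ v}
  mul_mem' hx hy v hv hP := mul_mem (hx v hv hP) (hy v hv hP)
  add_mem' hx hy v hv hP := add_mem (hx v hv hP) (hy v hv hP)
  algebraMap_mem' a _ hv _ := hv.2 a

/-- The local ring of `C` at `∞`, as an `Fq`-algebra. -/
def RationalPoint.localRing (P : RationalPoint Fq Q) : Subalgebra Fq Q where
  carrier := {x | x ∈ P.valuationRing}
  mul_mem' hx hy := P.valuationRing.mul_mem _ _ hx hy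
  add_mem' hx hy := P.valuationRing.add_mem _ _ hx hy
  algebraMap_mem' a := P.isPlace.2 a

variable (L : Type u) [Field L] [Algebra Fq L]

/-- The endomorphism `σ` of `B ⊗ L`, `b ⊗ x ↦ b ⊗ x ^ q` with `q = #Fq`. -/
def frob (Fq L B : Type u) [Field Fq] [Fintype Fq] [Field L] [Algebra Fq L]
    [CommRing B] [Algebra Fq B] : B ⊗[Fq] L →+* B ⊗[Fq] L :=
  (Algebra.TensorProduct.map (AlgHom.id Fq B) (FiniteField.frobeniusAlgHom Fq L)).toRingHom

theorem frob_tmul (B : Type u) [CommRing B] [Algebra Fq B] (b : B) (x : L) :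
    frob Fq L B (b ⊗ₜ[Fq] x) = b ⊗ₜ[Fq] (x ^ Fintype.card Fq) := rfl

/-- For a field `Q`, `σ` maps non-zero-divisors of `Q ⊗ L` to non-zero-divisors. -/
theorem frob_nonZeroDivisors :
    nonZeroDivisors (Q ⊗[Fq] L) ≤ (nonZeroDivisors (Q ⊗[Fq] L)).comap (frob Fq L Q) := by
  set F : Q ⊗[Fq] L →ₐ[Fq] Q ⊗[Fq] L :=
    Algebra.TensorProduct.map (FiniteField.frobeniusAlgHom Fq Q) (AlgHom.id Fq L) with hF
  have hinj : Function.Injective F := by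
    have h := Module.Flat.rTensor_preserves_injective_linearMap (M := L)
      (FiniteField.frobeniusAlgHom Fq Q).toLinearMap (FiniteField.frobeniusAlgHom Fq Q).injective
    exact h
  have hcomp : ∀ x, F (frob Fq L Q x) = x ^ Fintype.card Fq := by
    have h : F.comp (Algebra.TensorProduct.map (AlgHom.id Fq Q)
        (FiniteField.frobeniusAlgHom Fq L)) = FiniteField.frobeniusAlgHom Fq (Q ⊗[Fq] L) := by
      ext x
      · simp [hF]
      · simp [hF]
    exact fun x => DFunLike.congr_fun h x
  intro a ha
  rw [Submonoid.mem_comap, mem_nonZeroDivisors_iff_right]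
  intro y hy
  have h1 : F y * a ^ Fintype.card Fq = 0 := by
    rw [← hcomp, ← map_mul, hy, map_zero]
  have h2 : F y = 0 := (mul_right_mem_nonZeroDivisors_eq_zero_iff (pow_mem ha _)).1 h1
  exact hinj (h2.trans (map_zero F).symm)

variable (Fq Q)

/-- The function field of `C_L = C ×_{Fq} L`, the ring of fractions of `Q ⊗ L`. -/
def CurveField : Type u := FractionRing (Q ⊗[Fq] L)

instance : CommRing (CurveField Fq Q L) := inferInstanceAs (CommRing (FractionRing (Q ⊗[Fq] L)))

instance : Algebra (Q ⊗[Fq] L) (CurveField Fq Q L) :=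
  inferInstanceAs (Algebra (Q ⊗[Fq] L) (FractionRing (Q ⊗[Fq] L)))

instance : IsFractionRing (Q ⊗[Fq] L) (CurveField Fq Q L) :=
  inferInstanceAs (IsFractionRing (Q ⊗[Fq] L) (FractionRing (Q ⊗[Fq] L)))

variable {Fq Q}

/-- For a subring `B` of `Q`, the natural map from `B ⊗ L` to the function field of `C_L`. -/
def toCurveField (B : Subalgebra Fq Q) : B ⊗[Fq] L →+* CurveField Fq Q L :=
  (algebraMap (Q ⊗[Fq] L) (CurveField Fq Q L)).comp
    (Algebra.TensorProduct.map B.val (AlgHom.id Fq L)).toRingHom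

variable (Fq Q) in
/-- The endomorphism `σ` of the function field of `C_L`. -/
def frobCurveField : CurveField Fq Q L →+* CurveField Fq Q L :=
  IsLocalization.map (M := nonZeroDivisors (Q ⊗[Fq] L)) (T := nonZeroDivisors (Q ⊗[Fq] L))
    (CurveField Fq Q L) (frob Fq L Q) (frob_nonZeroDivisors L)

theorem frobCurveField_toCurveField (B : Subalgebra Fq Q) (x : B ⊗[Fq] L) :
    frobCurveField Fq Q L (toCurveField L B x) = toCurveField L B (frob Fq L B x) := by
  have h : ∀ y : B ⊗[Fq] L, frob Fq L Q ((Algebra.TensorProduct.map B.val (AlgHom.id Fq L)) y) =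
      (Algebra.TensorProduct.map B.val (AlgHom.id Fq L)) (frob Fq L B y) := by
    intro y
    induction y using TensorProduct.induction_on with
    | zero => simp
    | tmul b x => simp [frob_tmul]
    | add x y hx hy => simp only [map_add, hx, hy]
  refine (IsLocalization.map_eq (M := nonZeroDivisors (Q ⊗[Fq] L))
    (T := nonZeroDivisors (Q ⊗[Fq] L)) (Q := CurveField Fq Q L) (frob_nonZeroDivisors L) _).trans ?_
  exact congrArg (algebraMap (Q ⊗[Fq] L) (CurveField Fq Q L)) (h x)

namespace RationalPoint

variable (P : RationalPoint Fq Q)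

/-- The ring `A_L = A ⊗ L`. -/
def coordRing : Type u := P.affineRing ⊗[Fq] L

instance : CommRing (P.coordRing L) := inferInstanceAs (CommRing (P.affineRing ⊗[Fq] L))

/-- `L` acts on `A_L = A ⊗ L` through the right factor. -/
instance : Algebra L (P.coordRing L) :=
  RingHom.toAlgebra (S := P.coordRing L)
    (Algebra.TensorProduct.includeRight : L →ₐ[Fq] P.affineRing ⊗[Fq] L).toRingHom

/-- The identification of `A_L` with `A ⊗ L`. -/
def coordRingEquiv : P.coordRing L ≃+* P.affineRing ⊗[Fq] L := RingEquiv.refl _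

/-- The endomorphism `σ` of `A_L`. -/
def sigma : P.coordRing L →+* P.coordRing L := frob Fq L P.affineRing

instance : Algebra (P.coordRing L) (CurveField Fq Q L) :=
  RingHom.toAlgebra (R := P.coordRing L) (toCurveField L P.affineRing)

/-- The ideal of `𝒪_{C,∞} ⊗ L` that is generated by the maximal ideal of `𝒪_{C,∞}`. Its residue
ring is `L`, so it is the maximal ideal of the point `∞` of `C_L`. -/
def inftyIdeal : Ideal (P.localRing ⊗[Fq] L) :=
  Ideal.span {x | ∃ z : P.localRing, P.valuationRing.valuation (z : Q) < 1 ∧ x = z ⊗ₜ[Fq] (1 : L)}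

theorem frob_mem_inftyIdeal (x : P.localRing ⊗[Fq] L) (hx : x ∈ P.inftyIdeal L) :
    frob Fq L P.localRing x ∈ P.inftyIdeal L := by
  have h : P.inftyIdeal L ≤ (P.inftyIdeal L).comap (frob Fq L P.localRing) := by
    refine Ideal.span_le.2 ?_
    rintro _ ⟨z, hz, rfl⟩
    refine Ideal.subset_span ⟨z, hz, ?_⟩
    rw [frob_tmul, one_pow]
  exact h hx

/-- The local ring of `C_L` at the point `∞`, inside the function field. Every element of
`𝒪_{C,∞} ⊗ L` that does not vanish at `∞` becomes congruent to `1` modulo `inftyIdeal` after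
multiplication by a constant of `L`, so these denominators suffice. -/
def stalk : Subring (CurveField Fq Q L) where
  carrier := {x | ∃ a b : P.localRing ⊗[Fq] L, b - 1 ∈ P.inftyIdeal L ∧
    x * toCurveField L P.localRing b = toCurveField L P.localRing a}
  one_mem' := ⟨1, 1, by simp, by simp⟩
  zero_mem' := ⟨0, 1, by simp, by simp⟩
  neg_mem' := by
    rintro x ⟨a, b, hb, h⟩
    exact ⟨-a, b, hb, by rw [neg_mul, h, map_neg]⟩
  mul_mem' := by
    rintro x y ⟨a, b, hb, h⟩ ⟨a', b', hb', h'⟩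
    refine ⟨a * a', b * b', ?_, ?_⟩
    · have : b * b' - 1 = (b - 1) * b' + (b' - 1) := by ring
      rw [this]
      exact add_mem (Ideal.mul_mem_right _ _ hb) hb'
    · rw [map_mul, map_mul, ← h, ← h']; ring
  add_mem' := by
    rintro x y ⟨a, b, hb, h⟩ ⟨a', b', hb', h'⟩
    refine ⟨a * b' + a' * b, b * b', ?_, ?_⟩
    · have : b * b' - 1 = (b - 1) * b' + (b' - 1) := by ring
      rw [this]
      exact add_mem (Ideal.mul_mem_right _ _ hb) hb'
    · rw [map_mul, map_add, map_mul, map_mul, ← h, ← h']; ring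

/-- The endomorphism `σ` of the local ring of `C_L` at `∞`. -/
def frobStalk : P.stalk L →+* P.stalk L :=
  (frobCurveField Fq Q L).restrict (P.stalk L) (P.stalk L) (by
    rintro x ⟨a, b, hb, h⟩
    refine ⟨frob Fq L _ a, frob Fq L _ b, ?_, ?_⟩
    · have := P.frob_mem_inftyIdeal L _ hb
      rwa [map_sub, map_one] at this
    · rw [← frobCurveField_toCurveField, ← frobCurveField_toCurveField, ← map_mul, h])

variable {L}

/-- For a submodule `N` over the local ring at `∞`, the module `N(k · ∞) = z^{-k} N`, where `z` is
a uniformizer at `∞`. -/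
def twist {V : Type u} [AddCommGroup V] [Module (CurveField Fq Q L) V]
    (N : Submodule (P.stalk L) V) (k : ℕ) : Submodule (P.stalk L) V where
  carrier := {v | ∀ z : Q, P.valuationRing.valuation z < 1 →
    algebraMap (Q ⊗[Fq] L) (CurveField Fq Q L) (z ⊗ₜ[Fq] (1 : L)) ^ k • v ∈ N}
  zero_mem' z _ := by rw [smul_zero]; exact N.zero_mem
  add_mem' hv hw z hz := by rw [smul_add]; exact N.add_mem (hv z hz) (hw z hz)
  smul_mem' s v hv z hz := by
    have h := N.smul_mem s (hv z hz)
    rwa [Subring.smul_def, smul_smul, mul_comm, ← smul_smul] at h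

end RationalPoint

end Curve

/-! ## Pure Anderson motives -/

section Motive

variable {Fq Q : Type u} [Field Fq] [Fintype Fq] [Field Q] [Algebra Fq Q]
  (P : RationalPoint Fq Q) {L : Type u} [Field L] [Algebra Fq L]

/-- The ideal `J` of `A_L` generated by the elements `a ⊗ 1 - 1 ⊗ c(a)`. -/
def charIdeal (c : P.affineRing →ₐ[Fq] L) : Ideal (P.coordRing L) :=
  Ideal.span (Set.range fun a : P.affineRing =>
    (P.coordRingEquiv L).symm (a ⊗ₜ[Fq] (1 : L) - 1 ⊗ₜ[Fq] c a))

variable {M : Type u} [AddCommGroup M] [Module (P.coordRing L) M]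

/-- The dimension over `L` of the cokernel of an `A_L`-linear map `σ^* M → M`. -/
def cokerDim (τ : Pullback (P.sigma L) M →ₗ[P.coordRing L] M) : Cardinal :=
  letI : Module L (M ⧸ LinearMap.range τ) :=
    Module.compHom _ (algebraMap L (P.coordRing L))
  Module.rank L (M ⧸ LinearMap.range τ)

/-- The map that `τ : σ^* M → M` induces on the generic fibre of `M`, written as the semilinear map
`f ⊗ m ↦ σ(f) ⊗ τ(1 ⊗ m)` over the function field of `C_L`. -/
def genericTau (τ : Pullback (P.sigma L) M →ₗ[P.coordRing L] M) :
    (CurveField Fq Q L ⊗[P.coordRing L] M) →ₛₗ[frobCurveField Fq Q L]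
      (CurveField Fq Q L ⊗[P.coordRing L] M) :=
  semilinearBaseChange (frobCurveField Fq Q L) (frobCurveField_toCurveField L P.affineRing)
    (τ.comp (Pullback.mk (P.sigma L)))

/-- The same map, considered as a semilinear map over the local ring of `C_L` at `∞`. -/
def stalkTau (τ : Pullback (P.sigma L) M →ₗ[P.coordRing L] M) :
    (CurveField Fq Q L ⊗[P.coordRing L] M) →ₛₗ[P.frobStalk L]
      (CurveField Fq Q L ⊗[P.coordRing L] M) where
  toFun := genericTau P τ
  map_add' := map_add _
  map_smul' s x := (genericTau P τ).map_smulₛₗ (s : CurveField Fq Q L) x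

/-- Purity. An extension of the locally free `A_L`-module `M` of rank `r` to a locally free sheaf
`ℳ` of rank `r` on `C_L` is the same as its stalk `N = ℳ_∞`, a free module of rank `r` over the
local ring at `∞` that spans the generic fibre of `M`. The motive is pure if for some such `N` and
some `k, l > 0` the map `τ^l` induces an isomorphism from `(σ^l)^* N` onto `N(k · ∞)`. -/
def IsPure (r : ℕ) (τ : Pullback (P.sigma L) M →ₗ[P.coordRing L] M) : Prop :=
  ∃ (b : Module.Basis (Fin r) (CurveField Fq Q L) (CurveField Fq Q L ⊗[P.coordRing L] M))
    (N : Submodule (P.stalk L) (CurveField Fq Q L ⊗[P.coordRing L] M)) (k l : ℕ),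
    N = Submodule.span (P.stalk L) (Set.range b) ∧ 0 < k ∧ 0 < l ∧
    Function.Injective (iterateOn (stalkTau P τ) N l) ∧
    LinearMap.range (iterateOn (stalkTau P τ) N l) = P.twist N k

/-- A pure Anderson motive over `L` of characteristic `c : A → L`. -/
structure PureAndersonMotive (c : P.affineRing →ₐ[Fq] L) where
  /-- the underlying `A_L`-module -/
  M : Type u
  [addCommGroup : AddCommGroup M]
  [module : Module (P.coordRing L) M]
  /-- the rank -/
  r : ℕ
  /-- the dimension -/
  d : ℕ
  finite : Module.Finite (P.coordRing L) M
  projective : Module.Projective (P.coordRing L) M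
  rank_eq : ∀ p : PrimeSpectrum (P.coordRing L), Module.rankAtStalk M p = r
  /-- the structure map `σ^* M → M` -/
  τ : Pullback (P.sigma L) M →ₗ[P.coordRing L] M
  injective : Function.Injective τ
  coker_dim : cokerDim P τ = d
  coker_ann : charIdeal P c ^ d ≤ Module.annihilator (P.coordRing L) (M ⧸ LinearMap.range τ)
  pure : IsPure P r τ

attribute [instance] PureAndersonMotive.addCommGroup PureAndersonMotive.module

variable {P} {c : P.affineRing →ₐ[Fq] L}

/-- A morphism of pure Anderson motives: an `A_L`-linear map `f` with `f ∘ τ = τ' ∘ σ^* f`. -/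
structure MotiveHom (X Y : PureAndersonMotive P c) where
  /-- the underlying `A_L`-linear map -/
  hom : X.M →ₗ[P.coordRing L] Y.M
  comm : hom ∘ₗ X.τ = Y.τ ∘ₗ Pullback.map (P.sigma L) hom

namespace MotiveHom

variable {X Y : PureAndersonMotive P c} (f : MotiveHom X Y)

/-- An isogeny is an injective morphism with torsion cokernel. -/
def IsIsogeny : Prop :=
  Function.Injective f.hom ∧ Module.IsTorsion (P.coordRing L) (Y.M ⧸ LinearMap.range f.hom)

/-- The map `σ^* coker f → coker f` induced by `τ`. -/
def cokerTau : Pullback (P.sigma L) (Y.M ⧸ LinearMap.range f.hom) →ₗ[P.coordRing L]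
    (Y.M ⧸ LinearMap.range f.hom) :=
  Pullback.lift (Submodule.mapQ (LinearMap.range f.hom) (LinearMap.range f.hom)
    (Y.τ.comp (Pullback.mk (P.sigma L))) (by
      rintro _ ⟨x, rfl⟩
      refine ⟨X.τ (Pullback.mk _ x), ?_⟩
      have h := LinearMap.congr_fun f.comm (Pullback.mk _ x)
      rw [LinearMap.comp_apply, LinearMap.comp_apply] at h
      refine h.trans ?_
      refine congrArg Y.τ ?_
      exact (Pullback.lift_tmul _ _ _).trans (one_smul _ _)))

/-- A separable isogeny is an isogeny for which `τ : σ^* coker f → coker f` is an isomorphism. -/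
def IsSeparableIsogeny : Prop :=
  f.IsIsogeny ∧ Function.Bijective f.cokerTau

end MotiveHom

/-- There is a separable isogeny from `X` to `Y`. -/
def SeparablyIsogenous (X Y : PureAndersonMotive P c) : Prop :=
  ∃ f : MotiveHom X Y, f.IsSeparableIsogeny

end Motive

end

/-!
Part 1. Let `f : X → Y` be a separable isogeny over a finite field `L`. Its cokernel is a finitely
generated torsion module over `A_L`, hence finite, and `τ` permutes it; so some `m > 0` satisfies
`σ ^ m = 1` on `A_L` and `τ ^ m = 1` on `coker f`. Then `1 - τ ^ m` is a linear endomorphism of `Y`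
with image in `f X`, and so it factors as `f ∘ g`. If `τ ^ m` fixed a vector `v ≠ 0` of `Y`, then a
power `τ ^ (m n)` would fix `v` while mapping the lattice at `∞` isomorphically onto its multiple by
a negative power of a uniformizer, which purity forbids: `v` would be infinitely divisible in the
lattice. Hence `1 - τ ^ m`, and with it `g : Y → X`, is injective with torsion cokernel. As
`g ∘ f = 1 - τ ^ m` too, `τ ^ m` is the identity on `coker g`, and `g` is separable.

Part 2. Let `γ ∈ L` not be a `q`-th power. The map `diag(t, 1)` is a separable isogeny from
`M' : e₁ ↦ e₁ + t e₂, e₂ ↦ γ e₁` to `M : e₁ ↦ e₁ + e₂, e₂ ↦ γ t e₁`, its cokernel being `A_L / t`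
with `τ = σ`. Let `h : M → M'` be a morphism, and `h e₂ ≡ (a, b)` modulo `t`. Then `τ e₂ ≡ 0` gives
`a ^ q + γ b ^ q = 0`, so `b = 0`, and then `τ e₁ = e₁ + e₂` puts `h e₁` on the line of `e₁` as
well. As `τ` maps `M'` into this line modulo `t`, the map that it induces on `coker h` is not
surjective.
-/

noncomputable section

section CurveFiniteness

open Polynomial

section PolynomialRelations

variable {k B ι : Type*} [CommRing k] [CommRing B] [Algebra k B] {x : B} {y : ι → B}
  {s : Finset ι} {p : ι → k[X]}

theorem aeval_eq_mul_aeval_divX_add (x : B) (p : k[X]) :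
    aeval x p = x * aeval x p.divX + algebraMap k B (p.coeff 0) := by
  conv_lhs => rw [← X_mul_divX_add p, map_add, map_mul, aeval_X, aeval_C]

theorem coeff_zero_eq_zero_of_sum_aeval_mul_eq_zero
    (hy : LinearIndependent k fun i => Ideal.Quotient.mk (Ideal.span {x}) (y i))
    (h : ∑ i ∈ s, aeval x (p i) * y i = 0) : ∀ i ∈ s, (p i).coeff 0 = 0 := by
  refine linearIndependent_iff'.1 hy s _ ?_
  have hx : Ideal.Quotient.mkₐ k (Ideal.span {x}) x = 0 :=
    Ideal.Quotient.eq_zero_iff_mem.2 (Ideal.mem_span_singleton_self x)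
  have hmod := congrArg (Ideal.Quotient.mkₐ k (Ideal.span {x})) h
  rw [map_sum, map_zero] at hmod
  rw [← hmod]
  refine Finset.sum_congr rfl fun i _ => ?_
  rw [aeval_eq_mul_aeval_divX_add x (p i), map_mul, map_add, map_mul, hx, zero_mul, zero_add,
    AlgHom.commutes, Algebra.smul_def, Ideal.Quotient.mkₐ_eq_mk]

theorem sum_aeval_divX_mul_eq_zero (hx : x ∈ nonZeroDivisors B)
    (h0 : ∀ i ∈ s, (p i).coeff 0 = 0) (h : ∑ i ∈ s, aeval x (p i) * y i = 0) :
    ∑ i ∈ s, aeval x (p i).divX * y i = 0 := by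
  refine (mul_left_mem_nonZeroDivisors_eq_zero_iff hx).1 ?_
  rw [← h, Finset.mul_sum]
  refine Finset.sum_congr rfl fun i hi => ?_
  rw [aeval_eq_mul_aeval_divX_add x (p i), h0 i hi, map_zero, add_zero, mul_assoc]

theorem eq_zero_of_sum_aeval_mul_eq_zero (hx : x ∈ nonZeroDivisors B)
    (hy : LinearIndependent k fun i => Ideal.Quotient.mk (Ideal.span {x}) (y i))
    (h : ∑ i ∈ s, aeval x (p i) * y i = 0) : ∀ i ∈ s, p i = 0 := by
  suffices hcoeff : ∀ n, ∀ i ∈ s, (p i).coeff n = 0 from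
    fun i hi => Polynomial.ext fun n => hcoeff n i hi
  intro n
  induction n generalizing p with
  | zero => exact coeff_zero_eq_zero_of_sum_aeval_mul_eq_zero hy h
  | succ n ih =>
    have h0 := coeff_zero_eq_zero_of_sum_aeval_mul_eq_zero hy h
    simpa only [coeff_divX] using ih (sum_aeval_divX_mul_eq_zero hx h0 h)

end PolynomialRelations

theorem linearIndependent_adjoin_of_linearIndependent_mk {k Q ι : Type*} [Field k] [Field Q]
    [Algebra k Q] (B : Subalgebra k Q) {x : B} (hx : x ≠ 0) {y : ι → B}
    (hy : LinearIndependent k fun i => Ideal.Quotient.mk (Ideal.span {x}) (y i)) :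
    LinearIndependent (Algebra.adjoin k {(x : Q)}) fun i => (y i : Q) := by
  rw [linearIndependent_iff']
  intro s g hg
  choose p hp using fun i => (Algebra.adjoin_singleton_eq_range_aeval k (x : Q)).le (g i).2
  have hB : ∑ i ∈ s, aeval x (p i) * y i = 0 := by
    apply Subtype.val_injective
    have hval : ∀ i, ((aeval x (p i) : B) : Q) = g i := fun i => by
      rw [← hp i]; exact (aeval_algHom_apply B.val x (p i)).symm
    simpa [hval, Subalgebra.smul_def] using hg
  intro i hi
  have hpi := eq_zero_of_sum_aeval_mul_eq_zero (mem_nonZeroDivisors_of_ne_zero hx) hy hB i hi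
  apply Subtype.val_injective
  rw [← hp i, hpi]
  exact map_zero _

theorem isUnit_of_isAlgebraic_of_ne_zero {k B : Type*} [Field k] [CommRing B] [IsDomain B]
    [Algebra k B] {x : B} (hx : IsAlgebraic k x) (hx0 : x ≠ 0) : IsUnit x := by
  have : Algebra.IsIntegral k (Algebra.adjoin k {x}) :=
    Algebra.IsIntegral.adjoin (by simpa using hx.isIntegral)
  have hfield : IsField (Algebra.adjoin k {x}) :=
    isField_of_isIntegral_of_isField' (Field.toIsField k)
  obtain ⟨y, hy⟩ := hfield.mul_inv_cancel
    (a := ⟨x, Algebra.self_mem_adjoin_singleton k x⟩) (fun h => hx0 (congrArg Subtype.val h))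
  exact IsUnit.of_mul_eq_one y (congrArg Subtype.val hy)

namespace IsCurveFunctionField

variable {Fq Q : Type*} [Field Fq] [Field Q] [Algebra Fq Q]

theorem finiteDimensional_adjoin (h : IsCurveFunctionField Fq Q) {x : Q}
    (hx : Transcendental Fq x) : FiniteDimensional (IntermediateField.adjoin Fq {x}) Q := by
  have hind : AlgebraicIndependent Fq (fun _ : Unit => x) :=
    algebraicIndependent_unique_type_iff.2 hx
  have hb : IsTranscendenceBasis Fq (fun _ : Unit => x) :=
    hind.isTranscendenceBasis_of_lift_trdeg_le_of_finite (by simp [h.trdeg_eq_one])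
  have halg := hb.isAlgebraic_field
  rw [Set.range_const] at halg
  have : Algebra.EssFiniteType Fq Q := IntermediateField.fg_top_iff.1 h.fg
  have : Algebra.EssFiniteType (IntermediateField.adjoin Fq {x}) Q :=
    Algebra.EssFiniteType.of_comp Fq _ _
  exact Algebra.finite_of_essFiniteType_of_isAlgebraic

open scoped IntermediateField.algebraAdjoinAdjoin in
theorem finiteDimensional_quotient_span (h : IsCurveFunctionField Fq Q) (B : Subalgebra Fq Q)
    {x : B} (hx : x ≠ 0) : FiniteDimensional Fq (B ⧸ Ideal.span {x}) := by
  by_cases hxa : IsAlgebraic Fq x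
  · rw [Ideal.span_singleton_eq_top.2 (isUnit_of_isAlgebraic_of_ne_zero hxa hx)]
    infer_instance
  have hxt : Transcendental Fq (x : Q) := fun h' => hxa
    ((isAlgebraic_algHom_iff B.val Subtype.val_injective).1 h')
  have := h.finiteDimensional_adjoin hxt
  have : Module.Free Fq (B ⧸ Ideal.span {x}) := Module.Free.of_divisionRing _ _
  let b := Module.Free.chooseBasis Fq (B ⧸ Ideal.span {x})
  choose y hy using fun i => Ideal.Quotient.mk_surjective (b i)
  have hind : LinearIndependent Fq fun i => Ideal.Quotient.mk (Ideal.span {x}) (y i) := by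
    simpa only [hy] using b.linearIndependent
  have hind' := (LinearIndependent.iff_fractionRing (Algebra.adjoin Fq {(x : Q)})
    (IntermediateField.adjoin Fq {(x : Q)})).1
      (linearIndependent_adjoin_of_linearIndependent_mk B hx hind)
  have := hind'.finite
  exact Module.Finite.of_basis b

theorem finite_quotient_span [Finite Fq] (h : IsCurveFunctionField Fq Q) (B : Subalgebra Fq Q)
    {x : B} (hx : x ≠ 0) : Finite (B ⧸ Ideal.span {x}) :=
  have := h.finiteDimensional_quotient_span B hx
  Module.finite_of_finite Fq

end IsCurveFunctionField

end CurveFiniteness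

section Uniformizer

namespace RationalPoint

variable {Fq Q : Type*} [Field Fq] [Field Q] [Algebra Fq Q] (P : RationalPoint Fq Q)

/-- `z` is a uniformizer at `P`, that is, a generator of the maximal ideal of the local ring; this
is expressed through the valuation, so that no discrete valuation has to be chosen. -/
structure IsUniformizer (z : Q) : Prop where
  valuation_lt_one : P.valuationRing.valuation z < 1
  valuation_le : ∀ {w}, P.valuationRing.valuation w < 1 →
    P.valuationRing.valuation w ≤ P.valuationRing.valuation z

theorem exists_ne_zero_valuation_lt_one :
    ∃ w ≠ 0, P.valuationRing.valuation w < 1 := by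
  obtain ⟨x, hx⟩ : ∃ x, x ∉ P.valuationRing := by
    by_contra! h
    exact P.isPlace.1 (eq_top_iff.2 fun x _ => h x)
  have hx0 : x ≠ 0 := by rintro rfl; exact hx P.valuationRing.zero_mem
  rw [← ValuationSubring.valuation_le_one_iff, not_le] at hx
  exact ⟨x⁻¹, inv_ne_zero hx0, by rw [map_inv₀]; exact inv_lt_one_of_one_lt₀ hx⟩

variable {P} in
theorem IsUniformizer.ne_zero {z : Q} (hz : P.IsUniformizer z) : z ≠ 0 := by
  rintro rfl
  obtain ⟨w, hw0, hw⟩ := P.exists_ne_zero_valuation_lt_one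
  exact hw0 (by simpa using hz.valuation_le hw)

section LocalRing

variable {Fq Q : Type u} [Field Fq] [Field Q] [Algebra Fq Q] (P : RationalPoint Fq Q)

instance : ValuationRing P.localRing := inferInstanceAs (ValuationRing P.valuationRing)

theorem mem_maximalIdeal_localRing {w : P.localRing} :
    w ∈ IsLocalRing.maximalIdeal P.localRing ↔ P.valuationRing.valuation (w : Q) < 1 :=
  (P.valuationRing.valuation_lt_one_iff w)

theorem maximalIdeal_localRing_fg [Finite Fq] (h : IsCurveFunctionField Fq Q) :
    (IsLocalRing.maximalIdeal P.localRing).FG := by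
  obtain ⟨w, hw0, hw⟩ := P.exists_ne_zero_valuation_lt_one
  let x : P.localRing := ⟨w, (P.valuationRing.valuation_le_one_iff w).1 hw.le⟩
  have hx : x ∈ IsLocalRing.maximalIdeal P.localRing := P.mem_maximalIdeal_localRing.2 hw
  have := h.finite_quotient_span P.localRing (x := x) fun h0 => hw0 (congrArg Subtype.val h0)
  refine Submodule.fg_of_fg_map_of_fg_inf_ker (Submodule.mkQ (Ideal.span {x})) ?_ ?_
  · exact Submodule.fg_def.2 ⟨_, Set.toFinite _, Submodule.span_eq _⟩
  · rw [Submodule.ker_mkQ, inf_eq_right.2 ((Ideal.span_singleton_le_iff_mem _).2 hx)]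
    exact Submodule.fg_span_singleton x

theorem exists_isUniformizer [Finite Fq] (h : IsCurveFunctionField Fq Q) :
    ∃ z, P.IsUniformizer z := by
  obtain ⟨z, hz⟩ := (IsBezout.isPrincipal_of_FG _ (P.maximalIdeal_localRing_fg h)).principal
  refine ⟨z, P.mem_maximalIdeal_localRing.1 (hz ▸ Submodule.mem_span_singleton_self z), ?_⟩
  intro w hw
  obtain ⟨a, ha⟩ : ∃ a : P.localRing, a * z = w := by
    have hmem := P.mem_maximalIdeal_localRing
      (w := ⟨w, (P.valuationRing.valuation_le_one_iff w).1 hw.le⟩) |>.2 hw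
    rw [hz] at hmem
    obtain ⟨a, ha⟩ := Submodule.mem_span_singleton.1 hmem
    exact ⟨a, congrArg Subtype.val ha⟩
  rw [← ha, map_mul]
  exact mul_le_of_le_one_left' ((P.valuationRing.valuation_le_one_iff _).2 a.2)

end LocalRing

end RationalPoint

end Uniformizer

section TorsionModules

open nonZeroDivisors

theorem isTorsion_quotient_range_of_injective {R W : Type*} [CommRing R] [IsDomain R]
    [AddCommGroup W] [Module R W] [Module.Finite R W] {φ : W →ₗ[R] W}
    (hφ : Function.Injective φ) : Module.IsTorsion R (W ⧸ LinearMap.range φ) := by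
  have hrank := rank_quotient_add_rank_of_isDomain (LinearMap.range φ)
  rw [rank_range_of_injective φ hφ] at hrank
  exact Module.rank_eq_zero_iff_isTorsion.1
    (Cardinal.eq_of_add_eq_add_right (hrank.trans (zero_add _).symm) (Module.rank_lt_aleph0 R W))

theorem algebraMap_mem_nonZeroDivisors_of_flat {R S : Type*} [CommRing R] [CommRing S]
    [Algebra R S] [Module.Flat R S] {r : R} (hr : r ∈ R⁰) : algebraMap R S r ∈ S⁰ := by
  rw [mem_nonZeroDivisors_iff_right]
  intro x hx
  refine Module.Flat.isSMulRegular_of_isRegular (M := S) (isRegular_iff_mem_nonZeroDivisors.2 hr) ?_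
  change r • x = r • 0
  rw [smul_zero, Algebra.smul_def, mul_comm, hx]

section Tower

variable (R : Type*) {S W : Type*} [CommRing R] [CommRing S] [Algebra R S]
  [AddCommGroup W] [Module R W] [Module S W] [IsScalarTower R S W]

variable [IsDomain R] [Module.Finite R S]

theorem isTorsion_restrictScalars (hW : Module.IsTorsion S W) : Module.IsTorsion R W := by
  intro w
  obtain ⟨s, hs⟩ := hW (x := w)
  have hinj : Function.Injective (LinearMap.mulRight R (s : S)) := fun x y hxy =>
    (mul_cancel_right_mem_nonZeroDivisors s.2).1 hxy
  obtain ⟨r, hr⟩ := isTorsion_quotient_range_of_injective hinj (x := Submodule.Quotient.mk 1)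
  obtain ⟨t, ht⟩ := (Submodule.Quotient.mk_eq_zero _).1 hr
  have hts : (t * s) • w = 0 := by rw [mul_smul]; exact (congrArg _ hs).trans (smul_zero t)
  refine ⟨r, (algebraMap_smul S (r : R) w).symm.trans ?_⟩
  rw [Algebra.algebraMap_eq_smul_one]
  exact (congrArg (· • w) ht).symm.trans hts

theorem isTorsion_quotient_range_of_injective_of_finite [Module.Flat R S] [Module.Finite S W]
    {φ : W →ₗ[S] W} (hφ : Function.Injective φ) :
    Module.IsTorsion S (W ⧸ LinearMap.range φ) := by
  have : Module.Finite R W := Module.Finite.trans S W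
  intro w
  obtain ⟨w, rfl⟩ := Submodule.Quotient.mk_surjective _ w
  obtain ⟨r, hr⟩ := isTorsion_quotient_range_of_injective (R := R) (φ := φ.restrictScalars R) hφ
    (x := Submodule.Quotient.mk w)
  refine ⟨⟨algebraMap R S r, algebraMap_mem_nonZeroDivisors_of_flat r.2⟩,
    (Submodule.Quotient.mk_eq_zero _).2 ?_⟩
  change algebraMap R S r • w ∈ LinearMap.range φ
  rw [algebraMap_smul]
  exact (Submodule.Quotient.mk_eq_zero _).1 hr

end Tower

theorem finite_of_isTorsion {R W : Type*} [CommRing R] [AddCommGroup W] [Module R W]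
    [Module.Finite R W] (hR : ∀ r ∈ R⁰, Finite (R ⧸ Ideal.span {r})) (hW : Module.IsTorsion R W) :
    Finite W := by
  obtain ⟨r, hr, hr0⟩ := Submodule.annihilator_top_inter_nonZeroDivisors hW
  have hann : Module.IsTorsionBySet R W (Ideal.span {r} : Ideal R) :=
    (Module.isTorsionBySet_span_singleton_iff r).2 fun w =>
      Submodule.mem_annihilator.1 hr w Submodule.mem_top
  let := hann.module
  have : IsScalarTower R (R ⧸ Ideal.span {r}) W := hann.isScalarTower
  have : Module.Finite (R ⧸ Ideal.span {r}) W := Module.Finite.of_restrictScalars_finite R _ _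
  have := hR r hr0
  exact Module.finite_of_finite (R ⧸ Ideal.span {r})

end TorsionModules

section Nakayama

theorem injective_sub_smul_of_surjective {R N : Type*} [CommRing R] [AddCommGroup N] [Module R N]
    [Module.Finite R N] {θ : N →ₗ[R] N} (hθ : Function.Surjective θ) {j : R}
    (hj : j ∈ Ideal.jacobson (⊥ : Ideal R)) :
    Function.Injective (θ - j • (LinearMap.id : N →ₗ[R] N)) := by
  refine OrzechProperty.injective_of_surjective_endomorphism _ (LinearMap.range_eq_top.1 ?_)
  refine top_le_iff.1 (Submodule.le_of_le_smul_of_le_jacobson_bot (I := Ideal.span {j})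
    Module.Finite.fg_top ((Ideal.span_singleton_le_iff_mem _).2 hj) fun y _ => ?_)
  obtain ⟨x, rfl⟩ := hθ y
  have h : θ x = (θ - j • (LinearMap.id : N →ₗ[R] N)) x + j • x := by simp
  rw [h]
  exact Submodule.add_mem_sup ⟨x, rfl⟩
    (Submodule.smul_mem_smul (Ideal.mem_span_singleton_self j) Submodule.mem_top)

end Nakayama

section SemilinearMaps

variable {R : Type*} [CommRing R] {σ : R →+* R} {M N : Type*} [AddCommGroup M] [Module R M]
  [AddCommGroup N] [Module R N]

namespace Pullback

theorem tmul_eq_smul_mk (a : R) (m : M) : Pullback.tmul σ a m = a • Pullback.mk σ m := by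
  change _ = a • Pullback.tmul σ 1 m
  rw [Pullback.smul_tmul, mul_one]

theorem lift_mk (φ : M →ₛₗ[σ] N) (m : M) : Pullback.lift φ (Pullback.mk σ m) = φ m :=
  (Pullback.lift_tmul φ 1 m).trans (one_smul _ _)

theorem map_mk (f : M →ₗ[R] N) (m : M) :
    Pullback.map σ f (Pullback.mk σ m) = Pullback.mk σ (f m) :=
  lift_mk _ m

theorem hom_ext {f g : Pullback σ M →ₗ[R] N}
    (h : ∀ m, f (Pullback.mk σ m) = g (Pullback.mk σ m)) : f = g := by
  refine LinearMap.ext fun x => ?_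
  induction x using Pullback.induction with
  | h0 => rw [map_zero, map_zero]
  | ht a m => rw [tmul_eq_smul_mk, map_smul, map_smul, h]
  | ha x y hx hy => rw [map_add, map_add, hx, hy]

theorem mk_bijective (hσ : Function.Bijective σ) :
    Function.Bijective (Pullback.mk σ : M → Pullback σ M) := by
  let e : R ≃ₗ[R] Twisted σ := LinearEquiv.ofBijective (Algebra.linearMap R (Twisted σ)) hσ
  have h : (Pullback.mk σ : M → Pullback σ M) =
      (TensorProduct.lid R M).symm.trans (e.rTensor M) := by
    refine funext fun m => ?_
    change (1 : Twisted σ) ⊗ₜ[R] m = e 1 ⊗ₜ[R] m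
    exact congrArg (· ⊗ₜ[R] m) (map_one (algebraMap R (Twisted σ))).symm
  rw [h]
  exact LinearEquiv.bijective _

theorem lift_bijective_iff (hσ : Function.Bijective σ) (φ : M →ₛₗ[σ] N) :
    Function.Bijective (Pullback.lift φ) ↔ Function.Bijective φ := by
  have h : (Pullback.lift φ ∘ Pullback.mk σ : M → N) = φ := funext (lift_mk φ)
  rw [← h, Function.Bijective.of_comp_iff _ (mk_bijective hσ)]

theorem lift_bijective_of_subsingleton [Subsingleton M] [Subsingleton N] (φ : M →ₛₗ[σ] N) :
    Function.Bijective (Pullback.lift φ) := by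
  have : Subsingleton (Pullback σ M) := inferInstanceAs (Subsingleton (Twisted σ ⊗[R] M))
  exact ⟨Function.injective_of_subsingleton _, fun y => ⟨0, Subsingleton.elim _ _⟩⟩

theorem exists_sum_smul_mk {ι : Type*} [Fintype ι] {e : ι → M}
    (he : Submodule.span R (Set.range e) = ⊤) (x : Pullback σ M) :
    ∃ a : ι → R, x = ∑ i, a i • Pullback.mk σ (e i) := by
  induction x using Pullback.induction with
  | h0 => exact ⟨0, by simp⟩
  | ht a m =>
    obtain ⟨b, rfl⟩ :=
      (Submodule.mem_span_range_iff_exists_fun R).1 (he.ge (Submodule.mem_top (x := m)))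
    refine ⟨fun i => a * σ (b i), ?_⟩
    simp only [tmul_eq_smul_mk, map_sum, map_smulₛₗ, Finset.smul_sum, mul_smul]
  | ha x y hx hy =>
    obtain ⟨a, rfl⟩ := hx
    obtain ⟨b, rfl⟩ := hy
    exact ⟨a + b, by simp only [Pi.add_apply, add_smul, Finset.sum_add_distrib]⟩

theorem lift_bijective_of_cyclic {φ : M →ₛₗ[σ] N} {k : M} (hk : Submodule.span R {k} = ⊤)
    (hφk : Submodule.span R {φ k} = ⊤) (h : ∀ a : R, a • φ k = 0 → a • Pullback.mk σ k = 0) :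
    Function.Bijective (Pullback.lift φ) := by
  constructor
  · rw [injective_iff_map_eq_zero]
    intro x hx
    obtain ⟨a, rfl⟩ := exists_sum_smul_mk (σ := σ) (e := fun _ : Unit => k)
      (by rwa [Set.range_const]) x
    rw [Fintype.sum_unique, map_smul, lift_mk] at hx
    rw [Fintype.sum_unique, h _ hx]
  · intro y
    obtain ⟨a, rfl⟩ := Submodule.mem_span_singleton.1 (hφk.ge (Submodule.mem_top (x := y)))
    exact ⟨a • Pullback.mk σ k, by rw [map_smul, lift_mk]⟩

section RightExactness

variable {M' : Type*} [AddCommGroup M'] [Module R M'] {i : M' →ₗ[R] M} {p : M →ₗ[R] N}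

theorem map_eq_lTensor (f : M →ₗ[R] N) :
    (Pullback.map σ f : Pullback σ M → Pullback σ N) = f.lTensor (Twisted σ) := by
  refine funext fun x => ?_
  induction x using Pullback.induction with
  | h0 => rw [map_zero]; exact (map_zero (f.lTensor (Twisted σ))).symm
  | ht a m =>
    rw [tmul_eq_smul_mk, map_smul, map_mk, ← tmul_eq_smul_mk, ← tmul_eq_smul_mk]
    rfl
  | ha x y hx hy => rw [map_add, hx, hy]; exact (map_add (f.lTensor (Twisted σ)) x y).symm

theorem map_surjective (hp : Function.Surjective p) :
    Function.Surjective (Pullback.map σ p) := by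
  rw [map_eq_lTensor]
  exact LinearMap.lTensor_surjective _ hp

theorem map_exact (hip : Function.Exact i p) (hp : Function.Surjective p) :
    Function.Exact (Pullback.map σ i) (Pullback.map σ p) := by
  rw [map_eq_lTensor, map_eq_lTensor]
  exact lTensor_exact _ hip hp

theorem lift_bijective_of_exact (hi : Function.Injective i) (hip : Function.Exact i p)
    (hp : Function.Surjective p) {φ' : M' →ₛₗ[σ] M'} {φ : M →ₛₗ[σ] M} {ψ : N →ₛₗ[σ] N}
    (hiφ : ∀ x, i (φ' x) = φ (i x)) (hpφ : ∀ x, p (φ x) = ψ (p x))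
    (hφ' : Function.Bijective (Pullback.lift φ')) (hψ : Function.Bijective (Pullback.lift ψ)) :
    Function.Bijective (Pullback.lift φ) := by
  have hmi : ∀ x, Pullback.lift φ (Pullback.map σ i x) = i (Pullback.lift φ' x) :=
    LinearMap.congr_fun (f := Pullback.lift φ ∘ₗ Pullback.map σ i) (g := i ∘ₗ Pullback.lift φ')
      (hom_ext fun x => by simp only [LinearMap.comp_apply, lift_mk, map_mk, hiφ])
  have hmp : ∀ x, Pullback.lift ψ (Pullback.map σ p x) = p (Pullback.lift φ x) :=
    LinearMap.congr_fun (f := Pullback.lift ψ ∘ₗ Pullback.map σ p) (g := p ∘ₗ Pullback.lift φ)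
      (hom_ext fun x => by simp only [LinearMap.comp_apply, lift_mk, map_mk, hpφ])
  constructor
  · rw [injective_iff_map_eq_zero]
    intro x hx
    obtain ⟨y, rfl⟩ := (map_exact hip hp x).1 (hψ.1 (by rw [hmp, hx, map_zero, map_zero]))
    have hy : Pullback.lift φ' y = 0 := hi (by rw [← hmi, hx, map_zero])
    rw [(map_eq_zero_iff _ hφ'.1).1 hy, map_zero]
  · intro z
    obtain ⟨w, hw⟩ := hψ.2 (p z)
    obtain ⟨x, rfl⟩ := map_surjective (σ := σ) hp w
    obtain ⟨y, hy⟩ := (hip (z - Pullback.lift φ x)).1 (by rw [map_sub, ← hmp, hw, sub_self])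
    obtain ⟨y, rfl⟩ := hφ'.2 y
    exact ⟨x + Pullback.map σ i y, by rw [map_add, hmi, hy, add_sub_cancel]⟩

end RightExactness

end Pullback

theorem iterateOn_mk (φ : M →ₛₗ[σ] M) (N : Submodule R M) (l : ℕ) (n : N) :
    iterateOn φ N l (Pullback.mk _ n) = φ^[l] n :=
  Pullback.lift_mk _ n

/-- The `m`-th iterate of a `σ`-semilinear endomorphism as a linear map, for `σ ^ m = 1`. -/
def linearIterate (φ : M →ₛₗ[σ] M) (m : ℕ) (hm : ∀ r, σ^[m] r = r) : M →ₗ[R] M where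
  toFun := φ^[m]
  map_add' := (semilinearIterate φ m).map_add
  map_smul' r x := by
    have h := (semilinearIterate φ m).map_smulₛₗ r x
    rw [RingHom.coe_pow, hm] at h
    exact h

end SemilinearMaps

section FrobeniusIterates

variable {Fq Q : Type u} [Field Fq] [Fintype Fq] [Field Q] [Algebra Fq Q]
  {L : Type u} [Field L] [Algebra Fq L]

variable (Fq L) in
theorem exists_pow_card_pow_eq [Finite L] :
    ∃ e : ℕ, 0 < e ∧ ∀ x : L, x ^ Fintype.card Fq ^ e = x := by
  have := Fintype.ofFinite L
  refine ⟨Module.finrank Fq L, Module.finrank_pos, fun x => ?_⟩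
  rw [← Module.card_eq_pow_finrank (K := Fq) (V := L), FiniteField.pow_card]

theorem frob_iterate_tmul {B : Type u} [CommRing B] [Algebra Fq B] (n : ℕ) (b : B) (x : L) :
    (frob Fq L B)^[n] (b ⊗ₜ x) = b ⊗ₜ (x ^ Fintype.card Fq ^ n) := by
  induction n with
  | zero => simp
  | succ n ih => rw [Function.iterate_succ_apply', ih, frob_tmul, ← pow_mul, pow_succ]

theorem frob_iterate_eq {m : ℕ} (hm : ∀ x : L, x ^ Fintype.card Fq ^ m = x) (B : Type u)
    [CommRing B] [Algebra Fq B] (x : B ⊗[Fq] L) : (frob Fq L B)^[m] x = x := by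
  induction x using TensorProduct.induction_on with
  | zero => exact iterate_map_zero _ _
  | tmul b x => rw [frob_iterate_tmul, hm]
  | add x y hx hy => rw [iterate_map_add, hx, hy]

theorem frobCurveField_algebraMap (x : Q ⊗[Fq] L) :
    frobCurveField Fq Q L (algebraMap _ _ x) = algebraMap _ (CurveField Fq Q L) (frob Fq L Q x) :=
  IsLocalization.map_eq (M := nonZeroDivisors (Q ⊗[Fq] L))
    (T := nonZeroDivisors (Q ⊗[Fq] L)) (Q := CurveField Fq Q L) (frob_nonZeroDivisors L) _

theorem frobCurveField_iterate_algebraMap (n : ℕ) (x : Q ⊗[Fq] L) :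
    (frobCurveField Fq Q L)^[n] (algebraMap _ _ x) =
      algebraMap _ (CurveField Fq Q L) ((frob Fq L Q)^[n] x) :=
  (Function.Semiconj.iterate_right (f := algebraMap _ (CurveField Fq Q L))
    (fun y => (frobCurveField_algebraMap y).symm) n x).symm

theorem frobCurveField_iterate_eq {m : ℕ} (hm : ∀ x : L, x ^ Fintype.card Fq ^ m = x)
    (x : CurveField Fq Q L) : (frobCurveField Fq Q L)^[m] x = x := by
  have h : (frobCurveField Fq Q L) ^ m = RingHom.id _ := by
    refine IsLocalization.ringHom_ext (nonZeroDivisors (Q ⊗[Fq] L)) (RingHom.ext fun y => ?_)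
    rw [RingHom.comp_apply, RingHom.coe_pow, frobCurveField_iterate_algebraMap,
      frob_iterate_eq hm]
    rfl
  rw [← RingHom.coe_pow, h, RingHom.id_apply]

namespace RationalPoint

variable (P : RationalPoint Fq Q)

theorem coe_frobStalk_iterate (n : ℕ) (x : P.stalk L) :
    (((P.frobStalk L)^[n] x : P.stalk L) : CurveField Fq Q L) = (frobCurveField Fq Q L)^[n] x :=
  Function.Semiconj.iterate_right (f := ((↑) : P.stalk L → CurveField Fq Q L)) (fun _ => rfl) n x

theorem frobStalk_iterate_eq {m : ℕ} (hm : ∀ x : L, x ^ Fintype.card Fq ^ m = x)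
    (x : P.stalk L) : (P.frobStalk L)^[m] x = x :=
  Subtype.val_injective ((P.coe_frobStalk_iterate m x).trans (frobCurveField_iterate_eq hm _))

theorem sigma_iterate_eq {m : ℕ} (hm : ∀ x : L, x ^ Fintype.card Fq ^ m = x)
    (a : P.coordRing L) : (P.sigma L)^[m] a = a :=
  frob_iterate_eq hm P.affineRing a

end RationalPoint

theorem bijective_of_iterate_eq {α : Type*} {f : α → α} {m : ℕ} (hm : 0 < m)
    (h : ∀ x, f^[m] x = x) : Function.Bijective f := by
  obtain ⟨n, rfl⟩ := Nat.exists_eq_succ_of_ne_zero hm.ne'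
  exact ⟨fun x y hxy => (h x).symm.trans ((congrArg f^[n] hxy).trans (h y)), fun x =>
    ⟨f^[n] x, (Function.iterate_succ_apply' f n x).symm.trans (h x)⟩⟩

end FrobeniusIterates

section Stalk

variable {Fq Q : Type u} [Field Fq] [Field Q] [Algebra Fq Q]
  {L : Type u} [Field L] [Algebra Fq L]

variable (Fq L) in
/-- The inclusion of the function field of `C` in that of `C_L`. -/
def ofFunction : Q →+* CurveField Fq Q L :=
  (algebraMap (Q ⊗[Fq] L) (CurveField Fq Q L)).comp
    (Algebra.TensorProduct.includeLeft : Q →ₐ[Fq] Q ⊗[Fq] L).toRingHom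

theorem frobCurveField_ofFunction [Fintype Fq] (z : Q) :
    frobCurveField Fq Q L (ofFunction Fq L z) = ofFunction Fq L z := by
  refine (frobCurveField_algebraMap _).trans (congrArg _ ?_)
  exact (frob_tmul _ _ z 1).trans (by rw [one_pow]; rfl)

theorem isUnit_ofFunction {z : Q} (hz : z ≠ 0) : IsUnit (ofFunction Fq L z) :=
  (isUnit_iff_ne_zero.2 hz).map _

namespace RationalPoint

variable (P : RationalPoint Fq Q)

theorem toCurveField_mem_stalk (a : P.localRing ⊗[Fq] L) :
    toCurveField L P.localRing a ∈ P.stalk L :=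
  ⟨a, 1, by simp, by simp⟩

theorem ofFunction_mem_stalk {z : Q} (hz : z ∈ P.valuationRing) :
    ofFunction Fq L z ∈ P.stalk L :=
  P.toCurveField_mem_stalk ((⟨z, hz⟩ : P.localRing) ⊗ₜ 1)

variable {P} in
theorem IsUniformizer.mem {z : Q} (hz : P.IsUniformizer z) : z ∈ P.valuationRing :=
  (P.valuationRing.valuation_le_one_iff z).1 hz.valuation_lt_one.le

variable {P} in
theorem IsUniformizer.mem_twist_iff {z : Q} (hz : P.IsUniformizer z)
    {V : Type u} [AddCommGroup V] [Module (CurveField Fq Q L) V] {N : Submodule (P.stalk L) V}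
    {k : ℕ} {v : V} : v ∈ P.twist N k ↔ ofFunction Fq L z ^ k • v ∈ N := by
  refine ⟨fun h => h z hz.valuation_lt_one, fun h w hw => ?_⟩
  have hc : w / z ∈ P.valuationRing := by
    rw [← P.valuationRing.valuation_le_one_iff, map_div₀]
    exact div_le_one_of_le₀ (hz.valuation_le hw) zero_le
  have h2 := N.smul_mem (⟨_, P.ofFunction_mem_stalk (L := L) hc⟩ ^ k : P.stalk L) h
  have h3 : ofFunction Fq L w = ofFunction Fq L (w / z) * ofFunction Fq L z := by
    rw [← map_mul, div_mul_cancel₀ _ hz.ne_zero]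
  change ofFunction Fq L w ^ k • v ∈ N
  rw [h3, mul_pow, mul_smul]
  exact h2

theorem inftyIdeal_le_jacobson [Finite L] : P.inftyIdeal L ≤ Ideal.jacobson ⊥ := by
  refine Ideal.span_le.2 ?_
  rintro _ ⟨z, hz, rfl⟩
  refine Ideal.mem_sInf.2 fun {J} hJ => ?_
  have : J.IsMaximal := hJ.2
  have : Module.Finite Fq L := Module.Finite.of_finite
  have hmax := Ideal.isMaximal_comap_of_isIntegral_of_isMaximal (R := P.localRing) J
  have hzmem := P.mem_maximalIdeal_localRing.2 hz
  rwa [← IsLocalRing.eq_maximalIdeal hmax] at hzmem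

theorem isUnit_of_sub_one_mem_inftyIdeal [Finite L] {b : P.localRing ⊗[Fq] L}
    (hb : b - 1 ∈ P.inftyIdeal L) : IsUnit b := by
  have h := Ideal.mem_jacobson_bot.1 (P.inftyIdeal_le_jacobson hb) 1
  rwa [mul_one, sub_add_cancel] at h

theorem ofFunction_mem_jacobson [Finite L] {z : Q} (hz : z ∈ P.valuationRing)
    (hz1 : P.valuationRing.valuation z < 1) :
    (⟨ofFunction Fq L z, P.ofFunction_mem_stalk hz⟩ : P.stalk L) ∈
      Ideal.jacobson (⊥ : Ideal (P.stalk L)) := by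
  rw [Ideal.mem_jacobson_bot]
  rintro ⟨y, a, b, hb, hy⟩
  let z' : P.localRing ⊗[Fq] L := (⟨z, hz⟩ : P.localRing) ⊗ₜ 1
  have hz' : toCurveField L P.localRing z' = ofFunction Fq L z := rfl
  have hzI : z' ∈ P.inftyIdeal L := Ideal.subset_span ⟨⟨z, hz⟩, hz1, rfl⟩
  have hu : IsUnit (b + z' * a) := P.isUnit_of_sub_one_mem_inftyIdeal (by
    rw [add_sub_right_comm]
    exact add_mem hb (Ideal.mul_mem_right _ _ hzI))
  obtain ⟨w, hw⟩ := hu.exists_right_inv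
  refine IsUnit.of_mul_eq_one ⟨_, P.toCurveField_mem_stalk (b * w)⟩ (Subtype.val_injective ?_)
  change (ofFunction Fq L z * y + 1) * toCurveField L P.localRing (b * w) = 1
  have h1 : toCurveField L P.localRing ((b + z' * a) * w) = 1 := by rw [hw, map_one]
  rw [map_mul, map_add, map_mul, hz', ← hy] at h1
  rw [map_mul]
  linear_combination h1

theorem exists_mul_mem_valuationRing (q : Q) :
    ∃ d ≠ 0, d ∈ P.valuationRing ∧ d * q ∈ P.valuationRing := by
  by_cases hq : q ∈ P.valuationRing
  · exact ⟨1, one_ne_zero, one_mem _, by rwa [one_mul]⟩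
  · have hq0 : q ≠ 0 := by rintro rfl; exact hq P.valuationRing.zero_mem
    exact ⟨q⁻¹, inv_ne_zero hq0, (P.valuationRing.mem_or_inv_mem q).resolve_left hq,
      by rw [inv_mul_cancel₀ hq0]; exact one_mem _⟩

theorem exists_ofFunction_mul_mem_stalk (p : Q ⊗[Fq] L) :
    ∃ d ≠ 0, d ∈ P.valuationRing ∧
      ofFunction Fq L d * algebraMap _ (CurveField Fq Q L) p ∈ P.stalk L := by
  induction p using TensorProduct.induction_on with
  | zero => exact ⟨1, one_ne_zero, one_mem _, by rw [map_zero, mul_zero]; exact zero_mem _⟩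
  | tmul q l =>
    obtain ⟨d, hd0, hd, hdq⟩ := P.exists_mul_mem_valuationRing q
    refine ⟨d, hd0, hd, ?_⟩
    have : ofFunction Fq L d * algebraMap _ (CurveField Fq Q L) (q ⊗ₜ[Fq] l) =
        toCurveField L P.localRing ((⟨d * q, hdq⟩ : P.localRing) ⊗ₜ l) := by
      change algebraMap _ (CurveField Fq Q L) (d ⊗ₜ[Fq] (1 : L)) * _ =
        algebraMap _ (CurveField Fq Q L) ((d * q) ⊗ₜ[Fq] l)
      rw [← map_mul, Algebra.TensorProduct.tmul_mul_tmul, one_mul]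
    rw [this]
    exact P.toCurveField_mem_stalk _
  | add x y hx hy =>
    obtain ⟨d, hd0, hd, h⟩ := hx
    obtain ⟨d', hd0', hd', h'⟩ := hy
    refine ⟨d * d', mul_ne_zero hd0 hd0', mul_mem hd hd', ?_⟩
    have : ofFunction Fq L (d * d') * algebraMap _ (CurveField Fq Q L) (x + y) =
        ofFunction Fq L d' * (ofFunction Fq L d * algebraMap _ (CurveField Fq Q L) x) +
        ofFunction Fq L d * (ofFunction Fq L d' * algebraMap _ (CurveField Fq Q L) y) := by
      rw [map_mul, map_add]; ring
    rw [this]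
    exact add_mem (mul_mem (P.ofFunction_mem_stalk hd') h) (mul_mem (P.ofFunction_mem_stalk hd) h')

theorem exists_isUnit_mul_mem_stalk (x : CurveField Fq Q L) :
    ∃ u ∈ P.stalk L, IsUnit u ∧ u * x ∈ P.stalk L := by
  obtain ⟨⟨p, s⟩, hx⟩ := IsLocalization.surj (nonZeroDivisors (Q ⊗[Fq] L)) x
  have hs : IsUnit (algebraMap (Q ⊗[Fq] L) (CurveField Fq Q L) s) := IsLocalization.map_units _ s
  obtain ⟨d, hd0, hd, h⟩ := P.exists_ofFunction_mul_mem_stalk p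
  obtain ⟨d', hd0', hd', h'⟩ := P.exists_ofFunction_mul_mem_stalk (s : Q ⊗[Fq] L)
  refine ⟨ofFunction Fq L d * (ofFunction Fq L d' * algebraMap _ _ (s : Q ⊗[Fq] L)),
    mul_mem (P.ofFunction_mem_stalk hd) h',
    (isUnit_ofFunction hd0).mul ((isUnit_ofFunction hd0').mul hs), ?_⟩
  convert mul_mem (P.ofFunction_mem_stalk hd') h using 1
  rw [← hx]
  ring

theorem exists_isUnit_smul_mem_span {V ι : Type*} [AddCommGroup V] [Module (CurveField Fq Q L) V]
    (b : Module.Basis ι (CurveField Fq Q L) V) (v : V) :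
    ∃ u : CurveField Fq Q L, IsUnit u ∧ u ∈ P.stalk L ∧
      u • v ∈ Submodule.span (P.stalk L) (Set.range b) := by
  have hv : v ∈ Submodule.span (CurveField Fq Q L) (Set.range b) := by
    rw [b.span_eq]; exact Submodule.mem_top
  induction hv using Submodule.span_induction with
  | mem x hx => exact ⟨1, isUnit_one, one_mem _, by rw [one_smul]; exact Submodule.subset_span hx⟩
  | zero => exact ⟨1, isUnit_one, one_mem _, by rw [smul_zero]; exact zero_mem _⟩
  | add x y _ _ hx hy =>
    obtain ⟨u, hu, hus, h⟩ := hx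
    obtain ⟨u', hu', hus', h'⟩ := hy
    refine ⟨u * u', hu.mul hu', mul_mem hus hus', ?_⟩
    rw [smul_add]
    refine add_mem ?_ ?_
    · rw [mul_comm, mul_smul]
      exact Submodule.smul_mem _ (⟨u', hus'⟩ : P.stalk L) h
    · rw [mul_smul]
      exact Submodule.smul_mem _ (⟨u, hus⟩ : P.stalk L) h'
  | smul a x _ hx =>
    obtain ⟨u, hu, hus, h⟩ := hx
    obtain ⟨w, hws, hw, hwa⟩ := P.exists_isUnit_mul_mem_stalk a
    refine ⟨w * u, hw.mul hu, mul_mem hws hus, ?_⟩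
    rw [smul_smul, mul_right_comm, mul_smul]
    exact Submodule.smul_mem _ (⟨w * a, hwa⟩ : P.stalk L) h

theorem linearIndependent_stalk {V ι : Type*} [AddCommGroup V] [Module (CurveField Fq Q L) V]
    (b : Module.Basis ι (CurveField Fq Q L) V) : LinearIndependent (P.stalk L) b :=
  b.linearIndependent.restrict_scalars fun s t h => by
    simpa only [Subring.smul_def, smul_eq_mul, mul_one, SetLike.coe_eq_coe] using h

end RationalPoint

end Stalk

section Purity

variable {Fq Q : Type u} [Field Fq] [Fintype Fq] [Field Q] [Algebra Fq Q]
  (P : RationalPoint Fq Q) {L : Type u} [Field L] [Algebra Fq L]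
  {V : Type u} [AddCommGroup V] [Module (CurveField Fq Q L) V]

/-- A semilinear endomorphism of a vector space over the function field of `C_L`, considered over
the local ring at `∞`. -/
def restrictStalk (T : V →ₛₗ[frobCurveField Fq Q L] V) : V →ₛₗ[P.frobStalk L] V where
  toFun := T
  map_add' := map_add T
  map_smul' s x := T.map_smulₛₗ (s : CurveField Fq Q L) x

/-- The condition that `IsPure` imposes on the generic fibre of a motive, for an arbitrary
semilinear endomorphism of a vector space over the function field of `C_L`. -/
def IsPureEndomorphism (r : ℕ) (T : V →ₛₗ[frobCurveField Fq Q L] V) : Prop :=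
  ∃ (b : Module.Basis (Fin r) (CurveField Fq Q L) V) (N : Submodule (P.stalk L) V) (k l : ℕ),
    N = Submodule.span (P.stalk L) (Set.range b) ∧ 0 < k ∧ 0 < l ∧
    Function.Injective (iterateOn (restrictStalk P T) N l) ∧
    LinearMap.range (iterateOn (restrictStalk P T) N l) = P.twist N k

theorem isPure_iff {M : Type u} [AddCommGroup M] [Module (P.coordRing L) M] (r : ℕ)
    (τ : Pullback (P.sigma L) M →ₗ[P.coordRing L] M) :
    IsPure P r τ ↔ IsPureEndomorphism P r (genericTau P τ) := Iff.rfl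

theorem iterate_ofFunction_pow_smul (T : V →ₛₗ[frobCurveField Fq Q L] V) (n : ℕ) (z : Q) (k : ℕ)
    (v : V) : T^[n] (ofFunction Fq L z ^ k • v) = ofFunction Fq L z ^ k • T^[n] v := by
  have h : Function.Commute T (ofFunction Fq L z ^ k • · : V → V) := fun v => by
    simp only [map_smulₛₗ, map_pow, frobCurveField_ofFunction]
  exact h.iterate_left n v

variable {P} {T : V →ₛₗ[frobCurveField Fq Q L] V} {z : Q}

theorem exists_surjective_of_range_iterateOn_eq_twist (hz : P.IsUniformizer z)
    (hσ : Function.Bijective (P.frobStalk L)) {N : Submodule (P.stalk L) V} {k l : ℕ}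
    (h : LinearMap.range (iterateOn (restrictStalk P T) N l) = P.twist N k) :
    ∃ S : N →ₛₗ[P.frobStalk L ^ l] N, Function.Surjective S ∧
      ∀ n : N, (S n : V) = ofFunction Fq L z ^ k • T^[l] n := by
  let S : N →ₛₗ[P.frobStalk L ^ l] N :=
    ((⟨ofFunction Fq L z, P.ofFunction_mem_stalk hz.mem⟩ ^ k : P.stalk L) •
      (semilinearIterate (restrictStalk P T) l).comp N.subtype).codRestrict N fun n =>
        hz.mem_twist_iff.1 (h ▸ ⟨Pullback.mk _ n, iterateOn_mk _ _ _ _⟩)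
  refine ⟨S, fun n => ?_, fun _ => rfl⟩
  obtain ⟨w, hw⟩ := ((isUnit_ofFunction (Fq := Fq) (L := L) hz.ne_zero).pow k).exists_right_inv
  have hwn : w • (n : V) ∈ P.twist N k := by
    rw [hz.mem_twist_iff (V := V), smul_smul, hw, one_smul]
    exact n.2
  rw [← h] at hwn
  obtain ⟨p, hp⟩ := hwn
  obtain ⟨n', rfl⟩ := (Pullback.mk_bijective (by rw [RingHom.coe_pow]; exact hσ.iterate l)).2 p
  have hn' : T^[l] (n' : V) = w • n := (iterateOn_mk _ _ _ _).symm.trans hp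
  refine ⟨n', Subtype.val_injective ?_⟩
  change ofFunction Fq L z ^ k • T^[l] n' = n
  rw [hn', smul_smul, hw, one_smul]

theorem coe_iterate_eq_of_coe_eq {N : Submodule (P.stalk L) V} {k l : ℕ} {S : N → N}
    (hS : ∀ n : N, (S n : V) = ofFunction Fq L z ^ k • T^[l] n) (j : ℕ) (n : N) :
    ((S^[j] n : N) : V) = ofFunction Fq L z ^ (k * j) • T^[l * j] n := by
  induction j with
  | zero => simp
  | succ j ih =>
    rw [Function.iterate_succ_apply', hS, ih, iterate_ofFunction_pow_smul, smul_smul,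
      ← Function.iterate_add_apply, ← pow_add, Nat.mul_succ, Nat.mul_succ, add_comm k, add_comm l]

theorem IsPureEndomorphism.eq_zero_of_iterate_eq [Finite L] (hC : IsCurveFunctionField Fq Q)
    {r : ℕ} (hT : IsPureEndomorphism P r T) {m : ℕ} (hm : 0 < m)
    (hmq : ∀ x : L, x ^ Fintype.card Fq ^ m = x) {v : V} (hv : T^[m] v = v) : v = 0 := by
  obtain ⟨b, N, k, l, hN, hk, -, -, hrange⟩ := hT
  obtain ⟨z, hz⟩ := P.exists_isUniformizer hC
  have hσ := bijective_of_iterate_eq hm (P.frobStalk_iterate_eq (L := L) hmq)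
  obtain ⟨S, hSsurj, hS⟩ := exists_surjective_of_range_iterateOn_eq_twist hz hσ hrange
  have hSm := coe_iterate_eq_of_coe_eq hS m
  have hσlm (s : P.stalk L) : (P.frobStalk L ^ l)^[m] s = s := by
    rw [RingHom.coe_pow, ← Function.iterate_mul, mul_comm, Function.iterate_mul]
    exact Function.iterate_fixed (P.frobStalk_iterate_eq hmq s) l
  let θ : N →ₗ[P.stalk L] N := linearIterate S m hσlm
  let ζ : P.stalk L := ⟨ofFunction Fq L z, P.ofFunction_mem_stalk hz.mem⟩
  have hζ : ζ ^ (k * m) ∈ Ideal.jacobson (⊥ : Ideal (P.stalk L)) :=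
    Ideal.pow_mem_of_mem _ (P.ofFunction_mem_jacobson hz.mem hz.valuation_lt_one) _
      (Nat.mul_pos hk hm)
  have : Module.Finite (P.stalk L) N :=
    Module.Finite.iff_fg.2 (hN ▸ Submodule.fg_span (Set.finite_range b))
  have hinj := injective_sub_smul_of_surjective (θ := θ) (hSsurj.iterate m) hζ
  obtain ⟨u, hu, -, huv⟩ := P.exists_isUnit_smul_mem_span b v
  rw [← hN] at huv
  have hTm : T^[l * m] (u • v) = u • v := by
    have hlin := linearIterate T m (frobCurveField_iterate_eq hmq) |>.map_smul u v
    have huvm : T^[m] (u • v) = u • v := hlin.trans (congrArg (u • ·) hv)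
    rw [mul_comm, Function.iterate_mul]
    exact Function.iterate_fixed huvm l
  have h0 : (⟨u • v, huv⟩ : N) = 0 := by
    apply hinj
    rw [map_zero, LinearMap.sub_apply, sub_eq_zero]
    exact Subtype.val_injective ((hSm _).trans (congrArg _ hTm))
  exact (IsUnit.smul_eq_zero hu).1 (congrArg Subtype.val h0)

end Purity

section GenericFibre

variable {Fq Q : Type u} [Field Fq] [Field Q] [Algebra Fq Q]
  {P : RationalPoint Fq Q} {L : Type u} [Field L] [Algebra Fq L]
  {M : Type u} [AddCommGroup M] [Module (P.coordRing L) M]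

theorem genericTau_one_tmul [Fintype Fq] (τ : Pullback (P.sigma L) M →ₗ[P.coordRing L] M) (m : M) :
    genericTau P τ (1 ⊗ₜ m) = 1 ⊗ₜ τ (Pullback.mk (P.sigma L) m) :=
  (semilinearBaseChange_tmul _ _ _ _ _).trans (by rw [map_one]; rfl)

theorem genericTau_iterate_one_tmul [Fintype Fq] (τ : Pullback (P.sigma L) M →ₗ[P.coordRing L] M)
    (n : ℕ) (m : M) :
    (genericTau P τ)^[n] (1 ⊗ₜ m) = 1 ⊗ₜ (τ.comp (Pullback.mk (P.sigma L)))^[n] m :=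
  (Function.Semiconj.iterate_right (f := fun m : M => (1 : CurveField Fq Q L) ⊗ₜ[P.coordRing L] m)
    (fun m => (genericTau_one_tmul τ m).symm) n m).symm

theorem toCurveField_injective (B : Subalgebra Fq Q) :
    Function.Injective (toCurveField L B) := by
  refine (IsFractionRing.injective (Q ⊗[Fq] L) (CurveField Fq Q L)).comp ?_
  exact Module.Flat.rTensor_preserves_injective_linearMap (M := L) B.val.toLinearMap
    Subtype.val_injective

theorem one_tmul_injective_of_flat [Module.Flat (P.coordRing L) M] :
    Function.Injective (fun m : M => (1 : CurveField Fq Q L) ⊗ₜ[P.coordRing L] m) := by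
  have h := Module.Flat.rTensor_preserves_injective_linearMap (M := M)
    (Algebra.linearMap (P.coordRing L) (CurveField Fq Q L)) (toCurveField_injective P.affineRing)
  intro m n hmn
  have h2 := @h (1 ⊗ₜ m) (1 ⊗ₜ n) (by
    rw [LinearMap.rTensor_tmul, LinearMap.rTensor_tmul, Algebra.linearMap_apply, map_one]
    exact hmn)
  simpa using congrArg (TensorProduct.lid (P.coordRing L) M) h2

end GenericFibre

section SeparableIsogenies

open nonZeroDivisors

variable {Fq Q : Type u} [Field Fq] [Fintype Fq] [Field Q] [Algebra Fq Q]
  {P : RationalPoint Fq Q} {L : Type u} [Field L] [Algebra Fq L] {c : P.affineRing →ₐ[Fq] L}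

/-- The structure map of a motive as a semilinear map `m ↦ τ (1 ⊗ m)`. -/
def PureAndersonMotive.semilinearTau (X : PureAndersonMotive P c) : X.M →ₛₗ[P.sigma L] X.M :=
  X.τ.comp (Pullback.mk (P.sigma L))

namespace MotiveHom

variable {X Y Z : PureAndersonMotive P c}

theorem hom_semilinearTau (f : MotiveHom X Y) (x : X.M) :
    f.hom (X.semilinearTau x) = Y.semilinearTau (f.hom x) := by
  have h := LinearMap.congr_fun f.comm (Pullback.mk _ x)
  rwa [LinearMap.comp_apply, LinearMap.comp_apply, Pullback.map_mk] at h

theorem hom_semilinearTau_iterate (f : MotiveHom X Y) (m : ℕ) (x : X.M) :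
    f.hom (X.semilinearTau^[m] x) = Y.semilinearTau^[m] (f.hom x) :=
  Function.Semiconj.iterate_right (f := f.hom) f.hom_semilinearTau m x

/-- The morphism of motives given by a linear map that commutes with the semilinear structure
maps. -/
def ofSemilinear (f : X.M →ₗ[P.coordRing L] Y.M)
    (h : ∀ x, f (X.semilinearTau x) = Y.semilinearTau (f x)) : MotiveHom X Y where
  hom := f
  comm := Pullback.hom_ext fun m => by
    rw [LinearMap.comp_apply, LinearMap.comp_apply, Pullback.map_mk]
    exact h m

variable (X) in
/-- The identity morphism of a motive. -/
protected def id : MotiveHom X X := ofSemilinear LinearMap.id fun _ => rfl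

/-- The composite of two morphisms of motives. -/
def comp (g : MotiveHom Y Z) (f : MotiveHom X Y) : MotiveHom X Z :=
  ofSemilinear (g.hom ∘ₗ f.hom) fun x => by
    rw [LinearMap.comp_apply, f.hom_semilinearTau, g.hom_semilinearTau, LinearMap.comp_apply]

/-- The structure map that `τ` induces on `coker f`, as a semilinear map. -/
def cokerSemilinearTau (f : MotiveHom X Y) :
    (Y.M ⧸ LinearMap.range f.hom) →ₛₗ[P.sigma L] (Y.M ⧸ LinearMap.range f.hom) :=
  Submodule.mapQ _ _ Y.semilinearTau (by
    rintro _ ⟨x, rfl⟩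
    exact ⟨X.semilinearTau x, f.hom_semilinearTau x⟩)

theorem cokerTau_eq_lift (f : MotiveHom X Y) :
    f.cokerTau = Pullback.lift f.cokerSemilinearTau := rfl

theorem range_sup_range_eq_top {f : MotiveHom X Y} (hf : Function.Surjective f.cokerTau) :
    LinearMap.range f.hom ⊔ LinearMap.range Y.τ = ⊤ := by
  refine Submodule.eq_top_iff'.2 fun y => ?_
  obtain ⟨p, hp⟩ := hf (Submodule.Quotient.mk y)
  obtain ⟨p, rfl⟩ := Pullback.map_surjective (σ := P.sigma L)
    (Submodule.mkQ_surjective (LinearMap.range f.hom)) p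
  have hcomm : f.cokerTau ∘ₗ Pullback.map (P.sigma L) (LinearMap.range f.hom).mkQ =
      (LinearMap.range f.hom).mkQ ∘ₗ Y.τ := Pullback.hom_ext fun m => by
    rw [LinearMap.comp_apply, Pullback.map_mk, cokerTau_eq_lift, Pullback.lift_mk]
    rfl
  have hy : y - Y.τ p ∈ LinearMap.range f.hom :=
    (Submodule.Quotient.eq _).1 (hp.symm.trans (LinearMap.congr_fun hcomm p))
  exact Submodule.mem_sup.2 ⟨_, hy, _, ⟨p, rfl⟩, sub_add_cancel y _⟩

theorem cokerSemilinearTau_iterate_mk (f : MotiveHom X Y) (m : ℕ) (y : Y.M) :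
    f.cokerSemilinearTau^[m] (Submodule.Quotient.mk y) =
      Submodule.Quotient.mk (Y.semilinearTau^[m] y) :=
  (Function.Semiconj.iterate_right
    (f := (Submodule.Quotient.mk : Y.M → Y.M ⧸ LinearMap.range f.hom)) (fun _ => rfl) m y).symm

theorem isSeparableIsogeny_id : (MotiveHom.id X).IsSeparableIsogeny := by
  have : Subsingleton (X.M ⧸ LinearMap.range (MotiveHom.id X).hom) :=
    Submodule.Quotient.subsingleton_iff.2 LinearMap.range_id
  refine ⟨⟨Function.injective_id, fun {x} => ⟨1, Subsingleton.elim _ _⟩⟩, ?_⟩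
  exact Pullback.lift_bijective_of_subsingleton _

theorem IsIsogeny.comp {g : MotiveHom Y Z} {f : MotiveHom X Y} (hg : g.IsIsogeny)
    (hf : f.IsIsogeny) : (g.comp f).IsIsogeny := by
  refine ⟨hg.1.comp hf.1, fun {z} => ?_⟩
  obtain ⟨z, rfl⟩ := Submodule.Quotient.mk_surjective _ z
  obtain ⟨s, hs⟩ := hg.2 (x := Submodule.Quotient.mk z)
  obtain ⟨y, hy⟩ := (Submodule.Quotient.mk_eq_zero _).1 hs
  obtain ⟨t, ht⟩ := hf.2 (x := Submodule.Quotient.mk y)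
  obtain ⟨x, hx⟩ := (Submodule.Quotient.mk_eq_zero _).1 ht
  refine ⟨t * s, (Submodule.Quotient.mk_eq_zero _).2 ⟨x, ?_⟩⟩
  calc g.hom (f.hom x) = t • g.hom y := by rw [hx]; exact map_smul g.hom _ y
    _ = (t * s) • z := by rw [hy, mul_smul]; rfl

theorem IsSeparableIsogeny.comp {g : MotiveHom Y Z} {f : MotiveHom X Y}
    (hg : g.IsSeparableIsogeny) (hf : f.IsSeparableIsogeny) : (g.comp f).IsSeparableIsogeny := by
  refine ⟨hg.1.comp hf.1, ?_⟩
  let i : (Y.M ⧸ LinearMap.range f.hom) →ₗ[P.coordRing L] Z.M ⧸ LinearMap.range (g.comp f).hom :=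
    Submodule.mapQ _ _ g.hom (by rintro _ ⟨x, rfl⟩; exact ⟨x, rfl⟩)
  let p : (Z.M ⧸ LinearMap.range (g.comp f).hom) →ₗ[P.coordRing L] Z.M ⧸ LinearMap.range g.hom :=
    Submodule.factor (LinearMap.range_comp_le_range f.hom g.hom)
  have hi : Function.Injective i := by
    rw [injective_iff_map_eq_zero]
    intro y hy
    obtain ⟨y, rfl⟩ := Submodule.Quotient.mk_surjective _ y
    obtain ⟨x, hx⟩ := (Submodule.Quotient.mk_eq_zero _).1 hy
    exact (Submodule.Quotient.mk_eq_zero _).2 ⟨x, hg.1.1 hx⟩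
  have hip : Function.Exact i p := by
    intro z
    obtain ⟨z, rfl⟩ := Submodule.Quotient.mk_surjective _ z
    refine (Submodule.Quotient.mk_eq_zero _).trans ⟨?_, ?_⟩
    · rintro ⟨y, rfl⟩
      exact ⟨Submodule.Quotient.mk y, rfl⟩
    · rintro ⟨y, hy⟩
      obtain ⟨y, rfl⟩ := Submodule.Quotient.mk_surjective _ y
      obtain ⟨x, hx⟩ := (Submodule.Quotient.eq _).1 hy
      refine ⟨y - f.hom x, ?_⟩
      rw [map_sub, sub_eq_iff_eq_add]
      exact sub_eq_iff_eq_add'.1 hx.symm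
  refine Pullback.lift_bijective_of_exact hi hip (Submodule.factor_surjective _) ?_ ?_ hf.2 hg.2
  · intro y
    obtain ⟨y, rfl⟩ := Submodule.Quotient.mk_surjective _ y
    exact congrArg Submodule.Quotient.mk (g.hom_semilinearTau y)
  · intro z
    obtain ⟨z, rfl⟩ := Submodule.Quotient.mk_surjective _ z
    rfl

end MotiveHom

theorem SeparablyIsogenous.refl (X : PureAndersonMotive P c) : SeparablyIsogenous X X :=
  ⟨MotiveHom.id X, MotiveHom.isSeparableIsogeny_id⟩

theorem SeparablyIsogenous.trans {X Y Z : PureAndersonMotive P c}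
    (hXY : SeparablyIsogenous X Y) (hYZ : SeparablyIsogenous Y Z) : SeparablyIsogenous X Z := by
  obtain ⟨f, hf⟩ := hXY
  obtain ⟨g, hg⟩ := hYZ
  exact ⟨g.comp f, hg.comp hf⟩

section FiniteField

namespace RationalPoint

instance : Algebra P.affineRing (P.coordRing L) :=
  inferInstanceAs (Algebra P.affineRing (P.affineRing ⊗[Fq] L))

instance : Module.Flat P.affineRing (P.coordRing L) :=
  inferInstanceAs (Module.Flat P.affineRing (P.affineRing ⊗[Fq] L))

instance [Finite L] : Module.Finite P.affineRing (P.coordRing L) :=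
  have : Module.Finite Fq L := Module.Finite.of_finite
  inferInstanceAs (Module.Finite P.affineRing (P.affineRing ⊗[Fq] L))

variable (P L) in
theorem sigma_bijective [Finite L] : Function.Bijective (P.sigma L) := by
  obtain ⟨e, he, h⟩ := exists_pow_card_pow_eq Fq L
  exact bijective_of_iterate_eq he (P.sigma_iterate_eq h)

end RationalPoint

variable (Fq L) in
theorem exists_pow_card_pow_eq_and_iterate_eq [Finite L] {K : Type*} [Finite K] {φ : K → K}
    (hφ : Function.Bijective φ) :
    ∃ m, 0 < m ∧ (∀ x : L, x ^ Fintype.card Fq ^ m = x) ∧ ∀ k, φ^[m] k = k := by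
  obtain ⟨e, he, hL⟩ := exists_pow_card_pow_eq Fq L
  let π := Equiv.ofBijective φ hφ
  have hπ (k : K) : φ^[orderOf π] k = k := by
    have h := Equiv.congr_fun (pow_orderOf_eq_one π) k
    rwa [Equiv.Perm.coe_pow] at h
  refine ⟨e * orderOf π, Nat.mul_pos he (orderOf_pos π), fun x => ?_, fun k => ?_⟩
  · rw [pow_mul, ← congrFun (pow_iterate (Fintype.card Fq ^ e) (orderOf π)) x]
    exact Function.iterate_fixed (hL x) _
  · rw [mul_comm, Function.iterate_mul]
    exact Function.iterate_fixed (hπ k) e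

namespace PureAndersonMotive

variable (Y : PureAndersonMotive P c)

theorem eq_zero_of_iterate_eq [Finite L] (hC : IsCurveFunctionField Fq Q) {m : ℕ} (hm : 0 < m)
    (hmq : ∀ x : L, x ^ Fintype.card Fq ^ m = x) {y : Y.M}
    (hy : Y.semilinearTau^[m] y = y) : y = 0 := by
  have := Y.projective
  have h := ((isPure_iff P Y.r Y.τ).1 Y.pure).eq_zero_of_iterate_eq hC hm hmq
    (v := 1 ⊗ₜ y) ((genericTau_iterate_one_tmul Y.τ m y).trans (congrArg _ hy))
  exact one_tmul_injective_of_flat (h.trans (TensorProduct.tmul_zero _ _).symm)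

theorem isTorsion_quotient_range_of_injective [Finite L] {φ : Y.M →ₗ[P.coordRing L] Y.M}
    (hφ : Function.Injective φ) : Module.IsTorsion (P.coordRing L) (Y.M ⧸ LinearMap.range φ) := by
  let := Module.compHom Y.M (algebraMap P.affineRing (P.coordRing L))
  have : IsScalarTower P.affineRing (P.coordRing L) Y.M :=
    IsScalarTower.of_algebraMap_smul fun _ _ => rfl
  have := Y.finite
  exact isTorsion_quotient_range_of_injective_of_finite P.affineRing hφ

/-- `1 - τ ^ m`, which is linear when `x ^ q ^ m = x` on `L`. -/
def oneSubTauPow (m : ℕ) (hm : ∀ x : L, x ^ Fintype.card Fq ^ m = x) :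
    Y.M →ₗ[P.coordRing L] Y.M :=
  LinearMap.id - linearIterate Y.semilinearTau m (P.sigma_iterate_eq hm)

theorem oneSubTauPow_apply (m : ℕ) (hm : ∀ x : L, x ^ Fintype.card Fq ^ m = x) (y : Y.M) :
    Y.oneSubTauPow m hm y = y - Y.semilinearTau^[m] y := rfl

theorem oneSubTauPow_injective [Finite L] (hC : IsCurveFunctionField Fq Q) {m : ℕ} (hm : 0 < m)
    (hmq : ∀ x : L, x ^ Fintype.card Fq ^ m = x) :
    Function.Injective (Y.oneSubTauPow m hmq) := by
  rw [injective_iff_map_eq_zero]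
  intro y hy
  exact Y.eq_zero_of_iterate_eq hC hm hmq (sub_eq_zero.1 hy).symm

theorem oneSubTauPow_semilinearTau (m : ℕ) (hm : ∀ x : L, x ^ Fintype.card Fq ^ m = x) (y : Y.M) :
    Y.oneSubTauPow m hm (Y.semilinearTau y) = Y.semilinearTau (Y.oneSubTauPow m hm y) := by
  rw [oneSubTauPow_apply, oneSubTauPow_apply, map_sub,
    (Function.Commute.iterate_self Y.semilinearTau m).eq]

end PureAndersonMotive

namespace MotiveHom

variable {X Y : PureAndersonMotive P c} {f : MotiveHom X Y}

theorem IsIsogeny.finite_coker [Finite L] (hC : IsCurveFunctionField Fq Q) (hf : f.IsIsogeny) :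
    Finite (Y.M ⧸ LinearMap.range f.hom) := by
  let := Module.compHom (Y.M ⧸ LinearMap.range f.hom) (algebraMap P.affineRing (P.coordRing L))
  have : IsScalarTower P.affineRing (P.coordRing L) (Y.M ⧸ LinearMap.range f.hom) :=
    IsScalarTower.of_algebraMap_smul fun _ _ => rfl
  have := Y.finite
  have : Module.Finite P.affineRing (Y.M ⧸ LinearMap.range f.hom) :=
    Module.Finite.trans (P.coordRing L) _
  exact finite_of_isTorsion
    (fun r hr => hC.finite_quotient_span P.affineRing (nonZeroDivisors.ne_zero hr))
    (isTorsion_restrictScalars P.affineRing hf.2)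

theorem exists_comp_eq_oneSubTauPow (hf : Function.Injective f.hom) {m : ℕ}
    (hmq : ∀ x : L, x ^ Fintype.card Fq ^ m = x) (hmf : ∀ k, f.cokerSemilinearTau^[m] k = k) :
    ∃ g : MotiveHom Y X, ∀ y, f.hom (g.hom y) = Y.oneSubTauPow m hmq y := by
  have hrange (y : Y.M) : Y.oneSubTauPow m hmq y ∈ LinearMap.range f.hom :=
    (Submodule.Quotient.eq _).1 ((hmf _).symm.trans (f.cokerSemilinearTau_iterate_mk m y))
  let g : Y.M →ₗ[P.coordRing L] X.M :=
    (LinearEquiv.ofInjective f.hom hf).symm ∘ₗ (Y.oneSubTauPow m hmq).codRestrict _ hrange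
  have hfg (y : Y.M) : f.hom (g y) = Y.oneSubTauPow m hmq y :=
    congrArg Subtype.val ((LinearEquiv.ofInjective f.hom hf).apply_symm_apply _)
  refine ⟨ofSemilinear g fun y => hf ?_, hfg⟩
  rw [hfg, f.hom_semilinearTau, hfg, Y.oneSubTauPow_semilinearTau]

theorem isSeparableIsogeny_of_comp_eq_oneSubTauPow [Finite L] (hC : IsCurveFunctionField Fq Q)
    {g : MotiveHom Y X} {m : ℕ} (hm : 0 < m) (hmq : ∀ x : L, x ^ Fintype.card Fq ^ m = x)
    (hfg : ∀ y, f.hom (g.hom y) = Y.oneSubTauPow m hmq y)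
    (hgf : ∀ x, g.hom (f.hom x) = X.oneSubTauPow m hmq x) : g.IsSeparableIsogeny := by
  refine ⟨⟨fun y y' h => ?_, fun {x} => ?_⟩, ?_⟩
  · exact Y.oneSubTauPow_injective hC hm hmq (by rw [← hfg, ← hfg, h])
  · obtain ⟨x, rfl⟩ := Submodule.Quotient.mk_surjective _ x
    obtain ⟨s, hs⟩ := X.isTorsion_quotient_range_of_injective
      (X.oneSubTauPow_injective hC hm hmq) (x := Submodule.Quotient.mk x)
    obtain ⟨x', hx'⟩ := (Submodule.Quotient.mk_eq_zero _).1 hs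
    exact ⟨s, (Submodule.Quotient.mk_eq_zero _).2 ⟨f.hom x', (hgf x').trans hx'⟩⟩
  · rw [cokerTau_eq_lift, Pullback.lift_bijective_iff (P.sigma_bijective L)]
    refine bijective_of_iterate_eq hm fun x => ?_
    obtain ⟨x, rfl⟩ := Submodule.Quotient.mk_surjective _ x
    rw [cokerSemilinearTau_iterate_mk]
    exact ((Submodule.Quotient.eq (LinearMap.range g.hom)).2 ⟨f.hom x, hgf x⟩).symm

end MotiveHom

theorem SeparablyIsogenous.symm [Finite L] (hC : IsCurveFunctionField Fq Q)
    {X Y : PureAndersonMotive P c} (hXY : SeparablyIsogenous X Y) : SeparablyIsogenous Y X := by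
  obtain ⟨f, hf⟩ := hXY
  have hfin : Finite (Y.M ⧸ LinearMap.range f.hom) := hf.1.finite_coker hC
  have hφ : Function.Bijective f.cokerSemilinearTau :=
    (Pullback.lift_bijective_iff (P.sigma_bijective L) _).1 hf.2
  obtain ⟨m, hm, hmq, hmf⟩ := exists_pow_card_pow_eq_and_iterate_eq Fq L hφ
  obtain ⟨g, hfg⟩ := MotiveHom.exists_comp_eq_oneSubTauPow hf.1.1 hmq hmf
  have hgf (x : X.M) : g.hom (f.hom x) = X.oneSubTauPow m hmq x := hf.1.1 (by
    rw [hfg, Y.oneSubTauPow_apply, X.oneSubTauPow_apply, map_sub, f.hom_semilinearTau_iterate])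
  exact ⟨g, MotiveHom.isSeparableIsogeny_of_comp_eq_oneSubTauPow hC hm hmq hfg hgf⟩

theorem SeparablyIsogenous.equivalence [Finite L] (hC : IsCurveFunctionField Fq Q) :
    Equivalence (SeparablyIsogenous (P := P) (c := c)) :=
  ⟨SeparablyIsogenous.refl, SeparablyIsogenous.symm hC, SeparablyIsogenous.trans⟩

end FiniteField

end SeparableIsogenies

section ProjectiveLine

open Polynomial IsDedekindDomain

variable (Fq : Type u) [Field Fq]

open scoped Classical in
/-- The local ring of the projective line at `∞`. -/
def inftyValuationRing : ValuationSubring (RatFunc Fq) :=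
  (RatFunc.inftyValuation Fq).valuationSubring

variable {Fq}

open scoped Classical in
theorem mem_inftyValuationRing_iff {x : RatFunc Fq} :
    x ∈ inftyValuationRing Fq ↔ RatFunc.inftyValuation Fq x ≤ 1 := Iff.rfl

open scoped Classical in
theorem isEquiv_valuation_inftyValuationRing :
    (RatFunc.inftyValuation Fq).IsEquiv (inftyValuationRing Fq).valuation :=
  Valuation.isEquiv_valuation_valuationSubring _

open scoped Classical in
theorem inftyValuation_lt_one_iff_le {x : RatFunc Fq} :
    RatFunc.inftyValuation Fq x < 1 ↔ RatFunc.inftyValuation Fq x ≤ WithZero.exp (-1 : ℤ) := by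
  rcases eq_or_ne x 0 with rfl | hx
  · simp
  · rw [RatFunc.inftyValuation_apply, RatFunc.inftyValuation_of_nonzero Fq hx,
      ← WithZero.exp_zero, WithZero.exp_lt_exp, WithZero.exp_le_exp]
    omega

theorem X_notMem_inftyValuationRing : (RatFunc.X : RatFunc Fq) ∉ inftyValuationRing Fq := by
  classical
  rw [mem_inftyValuationRing_iff, RatFunc.inftyValuation.X, not_le, ← WithZero.exp_zero]
  exact WithZero.exp_lt_exp.2 one_pos

theorem isPlace_inftyValuationRing : IsPlace Fq (inftyValuationRing Fq) := by
  classical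
  refine ⟨fun h => X_notMem_inftyValuationRing (Fq := Fq) (by rw [h]; trivial), fun a => ?_⟩
  rw [mem_inftyValuationRing_iff, RatFunc.algebraMap_eq_C]
  rcases eq_or_ne a 0 with rfl | ha
  · simp
  · rw [RatFunc.inftyValuation.C _ ha]

theorem div_mem_inftyValuationRing_iff {p q : Fq[X]} (hq : q ≠ 0) :
    algebraMap Fq[X] (RatFunc Fq) p / algebraMap Fq[X] (RatFunc Fq) q ∈ inftyValuationRing Fq ↔
      p.degree ≤ q.degree := by
  classical
  rcases eq_or_ne p 0 with rfl | hp
  · simp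
  · rw [mem_inftyValuationRing_iff, map_div₀, RatFunc.inftyValuation_apply,
      RatFunc.inftyValuation_apply, RatFunc.inftyValuation.polynomial Fq hp,
      RatFunc.inftyValuation.polynomial Fq hq, ← WithZero.exp_sub, ← WithZero.exp_zero,
      WithZero.exp_le_exp, degree_eq_natDegree hp, degree_eq_natDegree hq, Nat.cast_le]
    omega

theorem valuation_div_lt_one {p q : Fq[X]} (h : p.degree < q.degree) :
    (inftyValuationRing Fq).valuation
      (algebraMap Fq[X] (RatFunc Fq) p / algebraMap Fq[X] (RatFunc Fq) q) < 1 := by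
  classical
  rcases eq_or_ne p 0 with rfl | hp
  · simp
  · have hq : q ≠ 0 := by rintro rfl; simp at h
    rw [← isEquiv_valuation_inftyValuationRing.lt_one_iff_lt_one, map_div₀,
      RatFunc.inftyValuation_apply, RatFunc.inftyValuation_apply,
      RatFunc.inftyValuation.polynomial Fq hp, RatFunc.inftyValuation.polynomial Fq hq,
      ← WithZero.exp_sub, ← WithZero.exp_zero, WithZero.exp_lt_exp]
    rw [degree_eq_natDegree hp, degree_eq_natDegree hq, Nat.cast_lt] at h
    omega

theorem exists_degree_sub_C_mul_lt {p q : Fq[X]} (hq : q ≠ 0) (h : p.degree ≤ q.degree) :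
    ∃ a : Fq, (p - C a * q).degree < q.degree := by
  have hdiv : (p / q).degree ≤ 0 := by
    rcases h.lt_or_eq with h | h
    · rw [(Polynomial.div_eq_zero_iff hq).2 h, degree_zero]
      exact bot_le
    · have := degree_add_div hq h.ge
      rw [h, degree_eq_natDegree hq] at this
      rcases eq_or_ne (p / q) 0 with h0 | h0
      · simp [h0]
      · rw [degree_eq_natDegree h0] at this ⊢
        norm_cast at this ⊢
        omega
  refine ⟨(p / q).coeff 0, ?_⟩
  rw [← eq_C_of_degree_le_zero hdiv, mul_comm, ← EuclideanDomain.mod_eq_sub_mul_div]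
  exact EuclideanDomain.mod_lt p hq

theorem exists_valuation_sub_algebraMap_lt_one (x : RatFunc Fq) (hx : x ∈ inftyValuationRing Fq) :
    ∃ a : Fq, (inftyValuationRing Fq).valuation (x - algebraMap Fq _ a) < 1 := by
  have hq : algebraMap Fq[X] (RatFunc Fq) x.denom ≠ 0 := by simpa using x.denom_ne_zero
  rw [← x.num_div_denom, div_mem_inftyValuationRing_iff x.denom_ne_zero] at hx
  obtain ⟨a, ha⟩ := exists_degree_sub_C_mul_lt x.denom_ne_zero hx
  refine ⟨a, lt_of_eq_of_lt (congrArg _ ?_) (valuation_div_lt_one ha)⟩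
  rw [map_sub, map_mul, sub_div, mul_div_cancel_right₀ _ hq, x.num_div_denom,
    RatFunc.algebraMap_C, RatFunc.algebraMap_eq_C]

variable (Fq) in
/-- The point `∞` of the projective line. -/
def inftyPoint : RationalPoint Fq (RatFunc Fq) where
  valuationRing := inftyValuationRing Fq
  isPlace := isPlace_inftyValuationRing
  residue := exists_valuation_sub_algebraMap_lt_one

variable (Fq) in
theorem isUniformizer_inv_X : (inftyPoint Fq).IsUniformizer RatFunc.X⁻¹ := by
  classical
  have hX : RatFunc.inftyValuation Fq RatFunc.X⁻¹ = WithZero.exp (-1 : ℤ) := by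
    rw [map_inv₀, RatFunc.inftyValuation.X, WithZero.exp_neg]
  constructor
  · exact isEquiv_valuation_inftyValuationRing.lt_one_iff_lt_one.1
      (inftyValuation_lt_one_iff_le.2 hX.le)
  · intro w hw
    have h := isEquiv_valuation_inftyValuationRing.lt_one_iff_lt_one.2 hw
    exact (isEquiv_valuation_inftyValuationRing w _).1 (hX ▸ inftyValuation_lt_one_iff_le.1 h)

theorem X_mem_affineRing : (RatFunc.X : RatFunc Fq) ∈ (inftyPoint Fq).affineRing := by
  classical
  intro v hv hne
  by_contra hXv
  have : v.valuation.IsTrivialOn Fq := ⟨fun a ha => by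
    have h1 := (v.valuation_le_one_iff _).2 (hv.2 a)
    have h2 := (v.valuation_le_one_iff _).2 (hv.2 a⁻¹)
    rw [map_inv₀, map_inv₀] at h2
    refine le_antisymm h1 ?_
    exact (inv_le_one₀ (zero_lt_iff.2 ((Valuation.ne_zero_iff _).2 (by simpa using ha)))).1 h2⟩
  have h1 : 1 < v.valuation RatFunc.X := not_le.1 fun h => hXv ((v.valuation_le_one_iff _).1 h)
  have h2 := RatFunc.valuation_isEquiv_inftyValuation_of_one_lt_valuation_X h1
  rw [Valuation.isEquiv_iff_valuationSubring, ValuationSubring.valuationSubring_valuation] at h2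
  exact hne h2

theorem algebraMap_mem_affineRing (p : Fq[X]) :
    algebraMap Fq[X] (RatFunc Fq) p ∈ (inftyPoint Fq).affineRing := by
  have hp : algebraMap Fq[X] (RatFunc Fq) p =
      aeval (⟨RatFunc.X, X_mem_affineRing⟩ : (inftyPoint Fq).affineRing) p := by
    rw [coe_aeval_mk_apply, ← RatFunc.algebraMap_X, aeval_algebraMap_apply, aeval_X_left_apply]
  rw [hp]
  exact Subtype.prop _

theorem exists_algebraMap_eq_of_mem_affineRing {x : RatFunc Fq}
    (hx : x ∈ (inftyPoint Fq).affineRing) : ∃ p : Fq[X], algebraMap Fq[X] (RatFunc Fq) p = x := by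
  refine HeightOneSpectrum.mem_integers_of_valuation_le_one (RatFunc Fq) x fun w => ?_
  let v := (w.valuation (RatFunc Fq)).valuationSubring
  have hXv : (RatFunc.X : RatFunc Fq) ∈ v := by
    rw [← RatFunc.algebraMap_X]
    exact w.valuation_le_one X
  refine hx v ⟨fun htop => ?_, fun a => ?_⟩ fun h => ?_
  · obtain ⟨π, hπ⟩ := w.valuation_exists_uniformizer (RatFunc Fq)
    have h : π⁻¹ ∈ v := by rw [htop]; trivial
    have h2 : w.valuation (RatFunc Fq) π⁻¹ ≤ 1 := h
    rw [map_inv₀, hπ, ← WithZero.exp_neg, ← WithZero.exp_zero, WithZero.exp_le_exp] at h2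
    norm_num at h2
  · rw [RatFunc.algebraMap_eq_C, ← RatFunc.algebraMap_C]
    exact w.valuation_le_one (C a)
  · rw [h] at hXv
    exact X_notMem_inftyValuationRing hXv

variable (Fq) in
/-- The ring of functions on the projective line that are regular away from `∞` is the polynomial
ring. -/
def affineRingEquiv : Fq[X] ≃ₐ[Fq] (inftyPoint Fq).affineRing :=
  AlgEquiv.ofBijective ((IsScalarTower.toAlgHom Fq Fq[X] (RatFunc Fq)).codRestrict _
    algebraMap_mem_affineRing) ⟨fun p q h =>
      RatFunc.algebraMap_injective Fq (congrArg Subtype.val h), fun x => by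
      obtain ⟨p, hp⟩ := exists_algebraMap_eq_of_mem_affineRing x.2
      exact ⟨p, Subtype.val_injective hp⟩⟩

theorem coe_affineRingEquiv (p : Fq[X]) :
    (affineRingEquiv Fq p : RatFunc Fq) = algebraMap Fq[X] (RatFunc Fq) p := rfl

variable (Fq) in
/-- The characteristic `Fq[t] → L`, `t ↦ 0`. -/
def zeroCharacteristic (L : Type u) [Field L] [Algebra Fq L] :
    (inftyPoint Fq).affineRing →ₐ[Fq] L :=
  (aeval (0 : L)).comp (affineRingEquiv Fq).symm.toAlgHom

theorem zeroCharacteristic_affineRingEquiv (L : Type u) [Field L] [Algebra Fq L] (p : Fq[X]) :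
    zeroCharacteristic Fq L (affineRingEquiv Fq p) = algebraMap Fq L (p.coeff 0) := by
  change aeval (0 : L) ((affineRingEquiv Fq).symm (affineRingEquiv Fq p)) = _
  rw [AlgEquiv.symm_apply_apply, ← coeff_zero_eq_aeval_zero']

end ProjectiveLine

section PurityCriterion

variable {Fq Q : Type u} [Field Fq] [Fintype Fq] [Field Q] [Algebra Fq Q]
  {P : RationalPoint Fq Q} {L : Type u} [Field L] [Algebra Fq L] {r k l : ℕ} {z : Q}
  {U : Matrix (Fin r) (Fin r) (P.stalk L)}

theorem ofFunction_pow_smul_iterateOn_sum {V : Type u} [AddCommGroup V]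
    [Module (CurveField Fq Q L) V] {T : V →ₛₗ[frobCurveField Fq Q L] V}
    {N : Submodule (P.stalk L) V} {e : Fin r → N} {b : Fin r → V}
    (h : ∀ j, ofFunction Fq L z ^ k • T^[l] (e j) = ∑ i, U i j • b i) (s : Fin r → P.stalk L) :
    ofFunction Fq L z ^ k •
      iterateOn (restrictStalk P T) N l (∑ j, s j • Pullback.mk _ (e j)) =
        ∑ i, U.mulVec s i • b i := by
  have hs (j : Fin r) : ofFunction Fq L z ^ k •
      iterateOn (restrictStalk P T) N l (s j • Pullback.mk _ (e j)) =
        ∑ i, (U i j * s j) • b i := by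
    rw [map_smul, iterateOn_mk, smul_comm]
    refine (congrArg (s j • ·) (h j)).trans ?_
    simp only [Finset.smul_sum, smul_smul, mul_comm]
  rw [map_sum, Finset.smul_sum, Finset.sum_congr rfl fun j _ => hs j, Finset.sum_comm]
  simp only [Matrix.mulVec, dotProduct, Finset.sum_smul]

theorem isPureEndomorphism_of_matrix {V : Type u} [AddCommGroup V] [Module (CurveField Fq Q L) V]
    {T : V →ₛₗ[frobCurveField Fq Q L] V} (hz : P.IsUniformizer z) (hk : 0 < k) (hl : 0 < l)
    (b : Module.Basis (Fin r) (CurveField Fq Q L) V) (hU : IsUnit U.det)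
    (h : ∀ j, ofFunction Fq L z ^ k • T^[l] (b j) = ∑ i, U i j • b i) :
    IsPureEndomorphism P r T := by
  let N : Submodule (P.stalk L) V := Submodule.span _ (Set.range b)
  let e (j : Fin r) : N := ⟨b j, Submodule.subset_span ⟨j, rfl⟩⟩
  have he : Submodule.span (P.stalk L) (Set.range e) = ⊤ := by
    refine Submodule.map_injective_of_injective N.injective_subtype ?_
    rw [Submodule.map_span, ← Set.range_comp, Submodule.map_top, Submodule.range_subtype]
    rfl
  let comb := Fintype.linearCombination (P.stalk L) b
  have hcomb : Function.Injective comb :=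
    (P.linearIndependent_stalk b).fintypeLinearCombination_injective
  have hrange : LinearMap.range comb = N := Fintype.range_linearCombination _ _
  have key (s : Fin r → P.stalk L) : ofFunction Fq L z ^ k • iterateOn (restrictStalk P T) N l
      (∑ j, s j • Pullback.mk _ (e j)) = comb (U.mulVec s) :=
    ofFunction_pow_smul_iterateOn_sum h s
  have hunit : IsUnit (ofFunction Fq L z ^ k) := (isUnit_ofFunction hz.ne_zero).pow k
  refine ⟨b, N, k, l, rfl, hk, hl, (injective_iff_map_eq_zero _).2 fun p hp => ?_, ?_⟩
  · obtain ⟨s, rfl⟩ := Pullback.exists_sum_smul_mk he p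
    have hUs : U.mulVec s = 0 := hcomb (by rw [← key, hp, smul_zero, map_zero])
    have hs : s = 0 := Matrix.mulVec_injective_of_isUnit ((Matrix.isUnit_iff_isUnit_det U).2 hU)
      (hUs.trans (Matrix.mulVec_zero U).symm)
    simp only [hs, Pi.zero_apply, zero_smul, Finset.sum_const_zero]
  · ext v
    rw [hz.mem_twist_iff]
    constructor
    · rintro ⟨p, rfl⟩
      obtain ⟨s, rfl⟩ := Pullback.exists_sum_smul_mk he p
      exact hrange.le ⟨_, (key s).symm⟩
    · intro hv
      obtain ⟨t, ht⟩ := hrange.ge hv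
      refine ⟨∑ j, U⁻¹.mulVec t j • Pullback.mk _ (e j), hunit.smul_left_cancel.1 ?_⟩
      rw [key, Matrix.mulVec_mulVec, Matrix.mul_nonsing_inv U hU, Matrix.one_mulVec, ht]

theorem isPure_lift_of_matrix
    {φ : (Fin r → P.coordRing L) →ₛₗ[P.sigma L] (Fin r → P.coordRing L)}
    (hz : P.IsUniformizer z) (hk : 0 < k) (hl : 0 < l) (hU : IsUnit U.det)
    (h : ∀ i j, (U i j : CurveField Fq Q L) =
      ofFunction Fq L z ^ k * algebraMap (P.coordRing L) _ (φ^[l] (Pi.single j 1) i)) :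
    IsPure P r (Pullback.lift φ) := by
  let b := Algebra.TensorProduct.basis (CurveField Fq Q L) (Pi.basisFun (P.coordRing L) (Fin r))
  have hφ : (Pullback.lift φ).comp (Pullback.mk (P.sigma L)) = φ :=
    LinearMap.ext fun m => Pullback.lift_mk φ m
  have hb (m : Fin r → P.coordRing L) :
      (1 : CurveField Fq Q L) ⊗ₜ[P.coordRing L] m =
        ∑ i, algebraMap _ (CurveField Fq Q L) (m i) • b i := by
    conv_lhs => rw [← (Pi.basisFun (P.coordRing L) (Fin r)).sum_repr m, TensorProduct.tmul_sum]
    simp only [b, Algebra.TensorProduct.basis_apply, algebraMap_smul, TensorProduct.tmul_smul,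
      Pi.basisFun_repr]
  refine (isPure_iff P r _).2 (isPureEndomorphism_of_matrix hz hk hl b hU fun j => ?_)
  rw [Algebra.TensorProduct.basis_apply, genericTau_iterate_one_tmul, hφ, Pi.basisFun_apply, hb,
    Finset.smul_sum]
  simp only [smul_smul, ← h, Subring.smul_def]

end PurityCriterion

section MatrixMaps

theorem span_range_pi_single (R ι : Type*) [CommRing R] [Finite ι] [DecidableEq ι] :
    Submodule.span R (Set.range fun i : ι => (Pi.single i 1 : ι → R)) = ⊤ := by
  rw [← (Pi.basisFun R ι).span_eq]
  exact congrArg _ (congrArg _ (funext fun i => (Pi.basisFun_apply R ι i).symm))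

variable {R n : Type*} [CommRing R] [Fintype n]

/-- The `σ`-semilinear endomorphism `v ↦ Φ σ(v)` of `Rⁿ`. -/
def semilinearOfMatrix (σ : R →+* R) (Φ : Matrix n n R) : (n → R) →ₛₗ[σ] (n → R) where
  toFun v := Φ.mulVec (σ ∘ v)
  map_add' v w := by
    rw [← Matrix.mulVec_add]
    exact congrArg _ (funext fun i => map_add σ (v i) (w i))
  map_smul' r v := by
    rw [← Matrix.mulVec_smul]
    exact congrArg _ (funext fun i => map_mul σ r (v i))

theorem semilinearOfMatrix_apply (σ : R →+* R) (Φ : Matrix n n R) (v : n → R) :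
    semilinearOfMatrix σ Φ v = Φ.mulVec (σ ∘ v) := rfl

variable {σ : R →+* R} {Φ : Matrix n n R}

theorem lift_semilinearOfMatrix_sum [DecidableEq n] (a : n → R) :
    Pullback.lift (semilinearOfMatrix σ Φ)
      (∑ i, a i • Pullback.mk σ (Pi.single i 1 : n → R)) = Φ.mulVec a := by
  have h (i : n) : semilinearOfMatrix σ Φ (Pi.single i 1) = Φ.mulVec (Pi.single i 1) := by
    rw [semilinearOfMatrix_apply]
    congr 1
    exact funext fun j => (Pi.apply_single (fun _ => σ) (fun _ => map_zero σ) i 1 j).trans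
      (by rw [map_one])
  simp only [map_sum, map_smul, Pullback.lift_mk, h]
  simp only [← Matrix.mulVec_smul, ← Matrix.mulVec_sum, ← Pi.basisFun_apply R n]
  exact congrArg _ ((Pi.basisFun R n).sum_repr a)

theorem lift_semilinearOfMatrix_injective [DecidableEq n] (hΦ : Φ.det ∈ nonZeroDivisors R) :
    Function.Injective (Pullback.lift (semilinearOfMatrix σ Φ)) := by
  rw [injective_iff_map_eq_zero]
  intro x hx
  obtain ⟨a, rfl⟩ := Pullback.exists_sum_smul_mk (span_range_pi_single R n) x
  rw [lift_semilinearOfMatrix_sum] at hx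
  have ha : a = 0 := Matrix.mulVec_injective_of_det_mem_nonZeroDivisors hΦ
    (hx.trans (Matrix.mulVec_zero Φ).symm)
  simp only [ha, Pi.zero_apply, zero_smul, Finset.sum_const_zero]

theorem range_lift_semilinearOfMatrix :
    LinearMap.range (Pullback.lift (semilinearOfMatrix σ Φ)) = LinearMap.range Φ.mulVecLin := by
  classical
  ext x
  constructor
  · rintro ⟨p, rfl⟩
    obtain ⟨a, rfl⟩ := Pullback.exists_sum_smul_mk (span_range_pi_single R n) p
    exact ⟨a, (lift_semilinearOfMatrix_sum a).symm⟩
  · rintro ⟨a, rfl⟩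
    exact ⟨_, lift_semilinearOfMatrix_sum a⟩

end MatrixMaps

section Characteristic

variable {Fq Q : Type u} [Field Fq] [Field Q] [Algebra Fq Q]
  {P : RationalPoint Fq Q} {L : Type u} [Field L] [Algebra Fq L] (c : P.affineRing →ₐ[Fq] L)

theorem RationalPoint.sigma_algebraMap_affineRing [Fintype Fq] (a : P.affineRing) :
    P.sigma L (algebraMap P.affineRing (P.coordRing L) a) = algebraMap _ _ a :=
  congrArg (fun x : L => (P.coordRingEquiv L).symm (a ⊗ₜ x)) (one_pow _)

theorem RationalPoint.sigma_algebraMap [Fintype Fq] (x : L) :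
    P.sigma L (algebraMap L (P.coordRing L) x) = algebraMap _ _ (x ^ Fintype.card Fq) := rfl

/-- The evaluation `A_L → L`, `a ⊗ x ↦ c(a) x`, at the point of `C_L` that the characteristic `c`
defines. -/
def evalCharacteristic : P.coordRing L →+* L :=
  (Algebra.TensorProduct.lift c (AlgHom.id Fq L) fun _ _ => .all _ _).toRingHom

theorem evalCharacteristic_tmul (a : P.affineRing) (x : L) :
    evalCharacteristic c ((P.coordRingEquiv L).symm (a ⊗ₜ x)) = c a * x :=
  Algebra.TensorProduct.lift_tmul ..

theorem evalCharacteristic_algebraMap (x : L) :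
    evalCharacteristic c (algebraMap L (P.coordRing L) x) = x :=
  (evalCharacteristic_tmul c 1 x).trans (by rw [map_one, one_mul])

theorem evalCharacteristic_algebraMap_affineRing (a : P.affineRing) :
    evalCharacteristic c (algebraMap P.affineRing (P.coordRing L) a) = c a :=
  (evalCharacteristic_tmul c a 1).trans (mul_one _)

theorem algebraMap_evalCharacteristic_sub_mem_charIdeal (x : P.coordRing L) :
    algebraMap L (P.coordRing L) (evalCharacteristic c x) - x ∈ charIdeal P c := by
  have h : ((Ideal.Quotient.mk (charIdeal P c)).comp (algebraMap L (P.coordRing L))).comp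
      (evalCharacteristic c) = Ideal.Quotient.mk (charIdeal P c) := by
    refine Algebra.TensorProduct.ringHom_ext (RingHom.ext fun a => ?_) (RingHom.ext fun x => ?_)
    · refine (congrArg _ (congrArg _ (evalCharacteristic_algebraMap_affineRing c a))).trans
        (Ideal.Quotient.eq.2 ?_).symm
      exact Ideal.subset_span ⟨a, rfl⟩
    · exact congrArg _ (congrArg _ (evalCharacteristic_algebraMap c x))
  exact Ideal.Quotient.eq.1 (RingHom.congr_fun h x)

theorem mem_charIdeal_iff {x : P.coordRing L} :
    x ∈ charIdeal P c ↔ evalCharacteristic c x = 0 := by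
  refine ⟨fun h => ?_, fun h => ?_⟩
  · have hle : charIdeal P c ≤ RingHom.ker (evalCharacteristic c) := by
      refine Ideal.span_le.2 ?_
      rintro _ ⟨a, rfl⟩
      change evalCharacteristic c ((P.coordRingEquiv L).symm (a ⊗ₜ 1 - 1 ⊗ₜ c a)) = 0
      rw [map_sub, map_sub, evalCharacteristic_tmul, evalCharacteristic_tmul, map_one, mul_one,
        one_mul, sub_self]
    exact hle h
  · have hx := algebraMap_evalCharacteristic_sub_mem_charIdeal c x
    rwa [h, map_zero, zero_sub, neg_mem_iff] at hx

variable {c} in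
theorem evalCharacteristic_sigma [Fintype Fq] (hc : ∀ a, c a ^ Fintype.card Fq = c a)
    (x : P.coordRing L) :
    evalCharacteristic c (P.sigma L x) = evalCharacteristic c x ^ Fintype.card Fq := by
  have h : (evalCharacteristic c).comp (P.sigma L) =
      (FiniteField.frobeniusAlgHom Fq L).toRingHom.comp (evalCharacteristic c) := by
    refine Algebra.TensorProduct.ringHom_ext (RingHom.ext fun a => ?_) (RingHom.ext fun x => ?_)
    · change evalCharacteristic c (P.sigma L (algebraMap _ _ a)) =
        evalCharacteristic c (algebraMap _ _ a) ^ Fintype.card Fq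
      rw [RationalPoint.sigma_algebraMap_affineRing, evalCharacteristic_algebraMap_affineRing, hc]
    · change evalCharacteristic c (P.sigma L (algebraMap _ _ x)) =
        evalCharacteristic c (algebraMap _ _ x) ^ Fintype.card Fq
      rw [RationalPoint.sigma_algebraMap, evalCharacteristic_algebraMap,
        evalCharacteristic_algebraMap]
  exact RingHom.congr_fun h x

variable {c} [Fintype Fq] {M : Type u} [AddCommGroup M] [Module (P.coordRing L) M]
  {τ : Pullback (P.sigma L) M →ₗ[P.coordRing L] M} {ℓ : M →ₗ[P.coordRing L] P.coordRing L}

theorem charIdeal_le_annihilator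
    (h : LinearMap.range τ = Submodule.comap ℓ (charIdeal P c)) :
    charIdeal P c ≤ Module.annihilator (P.coordRing L) (M ⧸ LinearMap.range τ) := by
  intro j hj
  rw [Module.mem_annihilator]
  intro k
  obtain ⟨x, rfl⟩ := Submodule.Quotient.mk_surjective _ k
  rw [← Submodule.Quotient.mk_smul, Submodule.Quotient.mk_eq_zero, h, Submodule.mem_comap, map_smul]
  exact Ideal.mul_mem_right _ _ hj

theorem cokerDim_eq_one (hℓ : Function.Surjective ℓ)
    (h : LinearMap.range τ = Submodule.comap ℓ (charIdeal P c)) : cokerDim P τ = 1 := by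
  unfold cokerDim
  let : Module L (M ⧸ LinearMap.range τ) := Module.compHom _ (algebraMap L (P.coordRing L))
  obtain ⟨e, he⟩ := hℓ 1
  refine Module.rank_eq_one_iff_finrank_eq_one.2 (finrank_eq_one
    (Submodule.Quotient.mk e) (fun h0 => ?_) fun k => ?_)
  · rw [Submodule.Quotient.mk_eq_zero, h, Submodule.mem_comap, he, mem_charIdeal_iff, map_one] at h0
    exact one_ne_zero h0
  · obtain ⟨x, rfl⟩ := Submodule.Quotient.mk_surjective _ k
    refine ⟨evalCharacteristic c (ℓ x), (Submodule.Quotient.eq _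
      (x := algebraMap L (P.coordRing L) (evalCharacteristic c (ℓ x)) • e)).2 ?_⟩
    rw [h, Submodule.mem_comap, map_sub, map_smul, he, smul_eq_mul, mul_one]
    exact algebraMap_evalCharacteristic_sub_mem_charIdeal c _

end Characteristic

section Line

open Polynomial

variable {Fq : Type u} [Field Fq] (L : Type u) [Field L] [Algebra Fq L]

/-- The inclusion `p ↦ p ⊗ 1` of `Fq[t]` in the coordinate ring `A_L` of the affine line. -/
def lineFunction : Fq[X] →+* (inftyPoint Fq).coordRing L :=
  (algebraMap (inftyPoint Fq).affineRing ((inftyPoint Fq).coordRing L)).comp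
    (affineRingEquiv Fq).toAlgHom.toRingHom

theorem algebraMap_lineFunction (p : Fq[X]) :
    algebraMap ((inftyPoint Fq).coordRing L) (CurveField Fq (RatFunc Fq) L) (lineFunction L p) =
      ofFunction Fq L (algebraMap Fq[X] (RatFunc Fq) p) := rfl

theorem lineFunction_C (b : Fq) :
    lineFunction L (C b) = algebraMap L _ (algebraMap Fq L b) :=
  (congrArg (algebraMap _ ((inftyPoint Fq).coordRing L)) ((affineRingEquiv Fq).commutes b)).trans
    ((Algebra.TensorProduct.includeLeft.commutes b).trans
      (Algebra.TensorProduct.includeRight.commutes b).symm)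

theorem evalCharacteristic_lineFunction (p : Fq[X]) :
    evalCharacteristic (zeroCharacteristic Fq L) (lineFunction L p) =
      algebraMap Fq L (p.coeff 0) :=
  (evalCharacteristic_algebraMap_affineRing _ _).trans (zeroCharacteristic_affineRingEquiv L p)

variable {L}

theorem lineFunction_mem_nonZeroDivisors {p : Fq[X]} (hp : p ≠ 0) :
    lineFunction L p ∈ nonZeroDivisors ((inftyPoint Fq).coordRing L) := by
  have hinj : Function.Injective
      (algebraMap ((inftyPoint Fq).coordRing L) (CurveField Fq (RatFunc Fq) L)) :=
    toCurveField_injective (inftyPoint Fq).affineRing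
  exact mem_nonZeroDivisors_of_injective hinj
    (isUnit_ofFunction (RatFunc.algebraMap_ne_zero hp)).mem_nonZeroDivisors

theorem charIdeal_zeroCharacteristic :
    charIdeal (inftyPoint Fq) (zeroCharacteristic Fq L) = Ideal.span {lineFunction L X} := by
  refine le_antisymm (Ideal.span_le.2 ?_) ((Ideal.span_singleton_le_iff_mem _).2 ?_)
  · rintro _ ⟨a, rfl⟩
    obtain ⟨p, rfl⟩ := (affineRingEquiv Fq).surjective a
    obtain ⟨q, hq⟩ := X_dvd_sub_C (p := p)
    refine Ideal.mem_span_singleton.2 ⟨lineFunction L q, ?_⟩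
    rw [← map_mul, ← hq, map_sub, lineFunction_C, ← zeroCharacteristic_affineRingEquiv]
    rfl
  · rw [mem_charIdeal_iff, evalCharacteristic_lineFunction, coeff_X_zero, map_zero]

variable [Fintype Fq]

theorem sigma_lineFunction (p : Fq[X]) :
    (inftyPoint Fq).sigma L (lineFunction L p) = lineFunction L p :=
  RationalPoint.sigma_algebraMap_affineRing _

theorem zeroCharacteristic_pow_card (a : (inftyPoint Fq).affineRing) :
    zeroCharacteristic Fq L a ^ Fintype.card Fq = zeroCharacteristic Fq L a := by
  obtain ⟨p, rfl⟩ := (affineRingEquiv Fq).surjective a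
  rw [zeroCharacteristic_affineRingEquiv, ← map_pow, FiniteField.pow_card]

end Line

section ConstantStalk

variable {Fq Q : Type u} [Field Fq] [Field Q] [Algebra Fq Q]
  (P : RationalPoint Fq Q) (L : Type u) [Field L] [Algebra Fq L]

/-- The constants `L` inside the local ring of `C_L` at `∞`. -/
def RationalPoint.constantStalk : L →+* P.stalk L :=
  ((algebraMap (P.coordRing L) (CurveField Fq Q L)).comp
    (algebraMap L (P.coordRing L))).codRestrict (P.stalk L) fun x =>
      P.toCurveField_mem_stalk ((1 : P.localRing) ⊗ₜ x)

end ConstantStalk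

section RankTwoMotives

open Polynomial

variable {Fq : Type u} [Field Fq] {L : Type u} [Field L] [Algebra Fq L]

/-- The matrix of the structure map `e₁ ↦ e₁ + β e₂`, `e₂ ↦ γ δ e₁`, whose determinant is `-t γ`
when `β δ = t`. -/
def pairMatrix (β δ : Fq[X]) (γ : L) : Matrix (Fin 2) (Fin 2) ((inftyPoint Fq).coordRing L) :=
  !![1, lineFunction L δ * algebraMap L _ γ; lineFunction L β, 0]

variable {β δ : Fq[X]} {γ : L}

theorem isUnit_algebraMap_coordRing (hγ : γ ≠ 0) :
    IsUnit (algebraMap L ((inftyPoint Fq).coordRing L) γ) :=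
  (isUnit_iff_ne_zero.2 hγ).map _

theorem pairMatrix_mulVec (a : Fin 2 → (inftyPoint Fq).coordRing L) :
    (pairMatrix β δ γ).mulVec a =
      ![a 0 + lineFunction L δ * algebraMap L _ γ * a 1, lineFunction L β * a 0] := by
  ext i
  fin_cases i
  · exact (Matrix.vec2_dotProduct _ _).trans (congrArg (· + _) (one_mul _))
  · exact (Matrix.vec2_dotProduct _ _).trans
      ((congrArg (_ + ·) (zero_mul _)).trans (add_zero _))

theorem det_pairMatrix_mem_nonZeroDivisors (hβδ : β * δ = X) (hγ : γ ≠ 0) :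
    (pairMatrix β δ γ).det ∈ nonZeroDivisors ((inftyPoint Fq).coordRing L) := by
  have hdet : (pairMatrix β δ γ).det =
      lineFunction L X * -algebraMap L ((inftyPoint Fq).coordRing L) γ := by
    rw [pairMatrix, Matrix.det_fin_two_of, ← hβδ, map_mul]
    ring
  rw [hdet]
  exact mul_mem (lineFunction_mem_nonZeroDivisors X_ne_zero)
    (isUnit_algebraMap_coordRing hγ).neg.mem_nonZeroDivisors

variable (L) in
/-- The linear form whose value mod `t` is the class of a vector in the cokernel of
`pairMatrix β δ γ`. -/
def pairForm (β : Fq[X]) :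
    (Fin 2 → (inftyPoint Fq).coordRing L) →ₗ[(inftyPoint Fq).coordRing L]
      (inftyPoint Fq).coordRing L :=
  LinearMap.proj 1 - lineFunction L β • LinearMap.proj 0

theorem pairForm_apply (x : Fin 2 → (inftyPoint Fq).coordRing L) :
    pairForm L β x = x 1 - lineFunction L β * x 0 := rfl

theorem pairForm_surjective : Function.Surjective (pairForm L β) := fun a =>
  ⟨![0, a], by rw [pairForm_apply]; exact (congrArg (a - ·) (mul_zero _)).trans (sub_zero a)⟩

theorem range_pairMatrix (hβδ : β * δ = X) (hγ : γ ≠ 0) :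
    LinearMap.range (pairMatrix β δ γ).mulVecLin =
      Submodule.comap (pairForm L β) (charIdeal (inftyPoint Fq) (zeroCharacteristic Fq L)) := by
  obtain ⟨γ', hγ'⟩ := (isUnit_algebraMap_coordRing (Fq := Fq) hγ).exists_right_inv
  have ht : lineFunction L β * lineFunction L δ = lineFunction L X := by rw [← map_mul, hβδ]
  ext x
  rw [Submodule.mem_comap, charIdeal_zeroCharacteristic, Ideal.mem_span_singleton, pairForm_apply]
  constructor
  · rintro ⟨a, rfl⟩
    refine ⟨-(algebraMap L _ γ * a 1), ?_⟩
    rw [Matrix.mulVecLin_apply, pairMatrix_mulVec]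
    change lineFunction L β * a 0 -
      lineFunction L β * (a 0 + lineFunction L δ * algebraMap L _ γ * a 1) = _
    linear_combination -(algebraMap L _ γ * a 1) * ht
  · rintro ⟨w, hw⟩
    refine ⟨![x 0 + lineFunction L δ * w, -(γ' * w)], ?_⟩
    rw [Matrix.mulVecLin_apply, pairMatrix_mulVec]
    ext i
    fin_cases i
    · change x 0 + lineFunction L δ * w + lineFunction L δ * algebraMap L _ γ * -(γ' * w) = x 0
      linear_combination -(w * lineFunction L δ) * hγ'
    · change lineFunction L β * (x 0 + lineFunction L δ * w) = x 1
      linear_combination w * ht - hw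

theorem ofFunction_inv_X_mul (hβδ : β * δ = X) :
    ofFunction Fq L RatFunc.X⁻¹ *
      (algebraMap _ (CurveField Fq (RatFunc Fq) L) (lineFunction L β) *
        algebraMap _ (CurveField Fq (RatFunc Fq) L) (lineFunction L δ)) = 1 := by
  rw [algebraMap_lineFunction, algebraMap_lineFunction, ← map_mul, ← map_mul, ← map_mul,
    hβδ, RatFunc.algebraMap_X, inv_mul_cancel₀ RatFunc.X_ne_zero, map_one]

theorem inv_X_mul_mem_inftyPoint {p : Fq[X]} (hp : p ∣ X) :
    RatFunc.X⁻¹ * algebraMap Fq[X] (RatFunc Fq) p ∈ (inftyPoint Fq).valuationRing := by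
  rw [mul_comm, ← div_eq_mul_inv, ← RatFunc.algebraMap_X]
  exact (div_mem_inftyValuationRing_iff X_ne_zero).2 (degree_le_of_dvd hp X_ne_zero)

variable [Fintype Fq]

variable (β δ γ) in
/-- The semilinear map with matrix `pairMatrix β δ γ`. -/
def pairTau : (Fin 2 → (inftyPoint Fq).coordRing L) →ₛₗ[(inftyPoint Fq).sigma L]
    (Fin 2 → (inftyPoint Fq).coordRing L) :=
  semilinearOfMatrix ((inftyPoint Fq).sigma L) (pairMatrix β δ γ)

theorem pairTau_apply (x : Fin 2 → (inftyPoint Fq).coordRing L) :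
    pairTau β δ γ x =
      ![(inftyPoint Fq).sigma L (x 0) +
          lineFunction L δ * algebraMap L _ γ * (inftyPoint Fq).sigma L (x 1),
        lineFunction L β * (inftyPoint Fq).sigma L (x 0)] :=
  pairMatrix_mulVec _

theorem range_lift_pairTau (hβδ : β * δ = X) (hγ : γ ≠ 0) :
    LinearMap.range (Pullback.lift (pairTau β δ γ)) =
      Submodule.comap (pairForm L β) (charIdeal (inftyPoint Fq) (zeroCharacteristic Fq L)) :=
  range_lift_semilinearOfMatrix.trans (range_pairMatrix hβδ hγ)

theorem pairTau_single_zero : pairTau β δ γ (Pi.single 0 1) = ![1, lineFunction L β] := by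
  simp [pairTau_apply]

theorem pairTau_single_one :
    pairTau β δ γ (Pi.single 1 1) = ![lineFunction L δ * algebraMap L _ γ, 0] := by
  simp [pairTau_apply]

theorem pairTau_pairTau_single_zero :
    pairTau β δ γ (pairTau β δ γ (Pi.single 0 1)) =
      ![1 + lineFunction L δ * algebraMap L _ γ * lineFunction L β, lineFunction L β] := by
  simp [pairTau_single_zero, pairTau_apply ![_, _], sigma_lineFunction]

theorem pairTau_pairTau_single_one :
    pairTau β δ γ (pairTau β δ γ (Pi.single 1 1)) =
      ![lineFunction L δ * algebraMap L _ (γ ^ Fintype.card Fq),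
        lineFunction L β * (lineFunction L δ * algebraMap L _ (γ ^ Fintype.card Fq))] := by
  simp [pairTau_single_one, pairTau_apply ![_, _], sigma_lineFunction,
    RationalPoint.sigma_algebraMap]

theorem inv_X_mul_pairTau_pairTau (hβδ : β * δ = X) (i j : Fin 2) :
    ofFunction Fq L RatFunc.X⁻¹ *
        algebraMap _ (CurveField Fq (RatFunc Fq) L)
          (pairTau β δ γ (pairTau β δ γ (Pi.single j 1)) i) =
      (!![ofFunction Fq L (RatFunc.X : RatFunc Fq)⁻¹ + (inftyPoint Fq).constantStalk L γ,
          ofFunction Fq L ((RatFunc.X : RatFunc Fq)⁻¹ * algebraMap _ _ δ) *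
            (inftyPoint Fq).constantStalk L (γ ^ Fintype.card Fq);
        ofFunction Fq L (RatFunc.X⁻¹ * algebraMap _ _ β),
          (inftyPoint Fq).constantStalk L (γ ^ Fintype.card Fq)] :
        Matrix (Fin 2) (Fin 2) (CurveField Fq (RatFunc Fq) L)) i j := by
  have ht := ofFunction_inv_X_mul (L := L) hβδ
  let a := algebraMap ((inftyPoint Fq).coordRing L) (CurveField Fq (RatFunc Fq) L)
  let c := algebraMap L ((inftyPoint Fq).coordRing L)
  let z := ofFunction Fq L (RatFunc.X : RatFunc Fq)⁻¹
  match j, i with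
  | 0, 0 =>
    rw [pairTau_pairTau_single_zero]
    change z * a (1 + lineFunction L δ * c γ * lineFunction L β) = z + a (c γ)
    rw [map_add, map_one, map_mul, map_mul]
    linear_combination a (c γ) * ht
  | 0, 1 =>
    rw [pairTau_pairTau_single_zero]
    exact (map_mul (ofFunction Fq L) _ _).symm
  | 1, 0 =>
    rw [pairTau_pairTau_single_one]
    change z * a (lineFunction L δ * c _) = ofFunction Fq L _ * a (c _)
    rw [map_mul, map_mul, ← algebraMap_lineFunction, mul_assoc]
  | 1, 1 =>
    rw [pairTau_pairTau_single_one]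
    change z * a (lineFunction L β * (lineFunction L δ * c _)) = a (c _)
    rw [map_mul, map_mul]
    linear_combination a (c (γ ^ Fintype.card Fq)) * ht

theorem isPure_pairTau (hβδ : β * δ = X) (hγ : γ ≠ 0) :
    IsPure (inftyPoint Fq) 2 (Pullback.lift (pairTau β δ γ)) := by
  let κ := (inftyPoint Fq).constantStalk L
  let Zβ : (inftyPoint Fq).stalk L := ⟨_, (inftyPoint Fq).ofFunction_mem_stalk
    (inv_X_mul_mem_inftyPoint ⟨δ, hβδ.symm⟩)⟩
  let Zδ : (inftyPoint Fq).stalk L := ⟨_, (inftyPoint Fq).ofFunction_mem_stalk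
    (inv_X_mul_mem_inftyPoint ⟨β, hβδ.symm.trans (mul_comm β δ)⟩)⟩
  let Z : (inftyPoint Fq).stalk L := ⟨_, (inftyPoint Fq).ofFunction_mem_stalk
    (isUniformizer_inv_X Fq).mem⟩
  have hZ : Zβ * Zδ = Z := Subtype.val_injective <| by
    change ofFunction Fq L _ * ofFunction Fq L _ = ofFunction Fq L _
    rw [map_mul, map_mul, ← algebraMap_lineFunction, ← algebraMap_lineFunction]
    linear_combination ofFunction Fq L RatFunc.X⁻¹ * ofFunction_inv_X_mul (L := L) hβδ
  refine isPure_lift_of_matrix (isUniformizer_inv_X Fq) one_pos two_pos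
    (U := !![Z + κ γ, Zδ * κ (γ ^ Fintype.card Fq); Zβ, κ (γ ^ Fintype.card Fq)]) ?_ ?_
  · have hdet : (Z + κ γ) * κ (γ ^ Fintype.card Fq) - Zδ * κ (γ ^ Fintype.card Fq) * Zβ =
        κ (γ * γ ^ Fintype.card Fq) := by
      rw [map_mul]
      linear_combination -κ (γ ^ Fintype.card Fq) * hZ
    rw [Matrix.det_fin_two_of, hdet]
    have hunit : IsUnit γ := isUnit_iff_ne_zero.2 hγ
    exact (hunit.mul (hunit.pow _)).map κ
  · intro i j
    rw [pow_one]
    refine Eq.trans ?_ (inv_X_mul_pairTau_pairTau hβδ i j).symm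
    fin_cases i <;> fin_cases j <;> rfl

/-- The pure Anderson motive `e₁ ↦ e₁ + β e₂`, `e₂ ↦ γ δ e₁` of rank two and dimension one. -/
def pairMotive (hβδ : β * δ = X) (hγ : γ ≠ 0) :
    PureAndersonMotive (inftyPoint Fq) (zeroCharacteristic Fq L) where
  M := Fin 2 → (inftyPoint Fq).coordRing L
  r := 2
  d := 1
  finite := inferInstance
  projective := inferInstance
  rank_eq p := by
    have : Nontrivial ((inftyPoint Fq).coordRing L) :=
      (evalCharacteristic (zeroCharacteristic Fq L)).domain_nontrivial
    rw [Module.rankAtStalk_eq_finrank_of_free, Pi.natCast_apply, Module.finrank_fin_fun]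
    rfl
  τ := Pullback.lift (pairTau β δ γ)
  injective := lift_semilinearOfMatrix_injective (det_pairMatrix_mem_nonZeroDivisors hβδ hγ)
  coker_dim := (cokerDim_eq_one pairForm_surjective
    (range_lift_pairTau hβδ hγ)).trans Nat.cast_one.symm
  coker_ann := (pow_one (charIdeal _ _)).le.trans
    (charIdeal_le_annihilator (range_lift_pairTau hβδ hγ))
  pure := isPure_pairTau hβδ hγ

theorem semilinearTau_pairMotive (hβδ : β * δ = X) (hγ : γ ≠ 0)
    (x : Fin 2 → (inftyPoint Fq).coordRing L) :
    (pairMotive hβδ hγ).semilinearTau x = pairTau β δ γ x :=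
  Pullback.lift_mk _ x

end RankTwoMotives

section Powers

theorem pow_ne_algebraMap_of_irreducible {R K : Type*} [CommRing R] [IsIntegrallyClosed R]
    [Field K] [Algebra R K] [IsFractionRing R K] {p : R} (hp : Irreducible p) {n : ℕ} (hn : 1 < n)
    (x : K) : x ^ n ≠ algebraMap R K p := by
  intro h
  obtain ⟨y, rfl⟩ := IsIntegrallyClosed.exists_algebraMap_eq_of_isIntegral_pow (R := R)
    (zero_lt_one.trans hn) (h ▸ isIntegral_algebraMap)
  rw [← map_pow] at h
  exact not_irreducible_pow hn.ne' (IsFractionRing.injective R K h ▸ hp)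

end Powers

section Asymmetry

open Polynomial

variable {Fq : Type u} [Field Fq] {L : Type u} [Field L] [Algebra Fq L]

variable (Fq L) in
/-- The endomorphism `diag(t, 1)` of `A_L ^ 2`. -/
def scaleFirst : (Fin 2 → (inftyPoint Fq).coordRing L) →ₗ[(inftyPoint Fq).coordRing L]
    (Fin 2 → (inftyPoint Fq).coordRing L) :=
  LinearMap.pi ![lineFunction L (X : Fq[X]) • LinearMap.proj 0, LinearMap.proj 1]

theorem scaleFirst_apply (x : Fin 2 → (inftyPoint Fq).coordRing L) :
    scaleFirst Fq L x = ![lineFunction L X * x 0, x 1] := by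
  ext i
  fin_cases i <;> rfl

theorem scaleFirst_injective : Function.Injective (scaleFirst Fq L) := by
  intro x y hxy
  rw [scaleFirst_apply, scaleFirst_apply] at hxy
  ext i
  fin_cases i
  · exact (mul_cancel_left_mem_nonZeroDivisors
      (lineFunction_mem_nonZeroDivisors X_ne_zero)).1 (congrFun hxy 0)
  · exact congrFun hxy 1

theorem mem_range_scaleFirst_iff {y : Fin 2 → (inftyPoint Fq).coordRing L} :
    y ∈ LinearMap.range (scaleFirst Fq L) ↔ lineFunction L X ∣ y 0 := by
  constructor
  · rintro ⟨x, rfl⟩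
    exact ⟨x 0, rfl⟩
  · rintro ⟨w, hw⟩
    refine ⟨![w, y 1], ?_⟩
    rw [scaleFirst_apply]
    ext i
    fin_cases i
    · exact hw.symm
    · rfl

variable [Fintype Fq] {γ : L}

theorem scaleFirst_pairTau (x : Fin 2 → (inftyPoint Fq).coordRing L) :
    scaleFirst Fq L (pairTau X 1 γ x) = pairTau 1 X γ (scaleFirst Fq L x) := by
  rw [scaleFirst_apply, scaleFirst_apply, pairTau_apply, pairTau_apply]
  ext i
  fin_cases i <;> simp [sigma_lineFunction, mul_add, mul_assoc]

/-- The motive `M' : e₁ ↦ e₁ + t e₂, e₂ ↦ γ e₁` of the counterexample. -/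
def subMotive (hγ : γ ≠ 0) : PureAndersonMotive (inftyPoint Fq) (zeroCharacteristic Fq L) :=
  pairMotive (mul_one X) hγ

/-- The motive `M : e₁ ↦ e₁ + e₂, e₂ ↦ γ t e₁` of the counterexample. -/
def superMotive (hγ : γ ≠ 0) : PureAndersonMotive (inftyPoint Fq) (zeroCharacteristic Fq L) :=
  pairMotive (one_mul X) hγ

/-- The inclusion `diag(t, 1) : M' → M` of the counterexample. -/
def subMotiveHom (hγ : γ ≠ 0) :
    MotiveHom (subMotive (Fq := Fq) hγ) (superMotive (Fq := Fq) hγ) :=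
  MotiveHom.ofSemilinear (scaleFirst Fq L) fun x =>
    (congrArg (scaleFirst Fq L) (semilinearTau_pairMotive _ hγ x)).trans
      ((scaleFirst_pairTau x).trans (semilinearTau_pairMotive _ hγ _).symm)

theorem isIsogeny_subMotiveHom (hγ : γ ≠ 0) : (subMotiveHom (Fq := Fq) hγ).IsIsogeny := by
  refine ⟨scaleFirst_injective, fun {y} => ?_⟩
  obtain ⟨y, rfl⟩ := Submodule.Quotient.mk_surjective _ y
  exact ⟨⟨_, lineFunction_mem_nonZeroDivisors X_ne_zero⟩,
    (Submodule.Quotient.mk_eq_zero _).2 (mem_range_scaleFirst_iff.2 ⟨_, rfl⟩)⟩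

theorem isSeparableIsogeny_subMotiveHom (hγ : γ ≠ 0) :
    (subMotiveHom (Fq := Fq) hγ).IsSeparableIsogeny := by
  refine ⟨isIsogeny_subMotiveHom hγ, ?_⟩
  let A := (inftyPoint Fq).coordRing L
  let K := (superMotive (Fq := Fq) hγ).M ⧸ LinearMap.range (subMotiveHom (Fq := Fq) hγ).hom
  let π : (Fin 2 → A) →ₗ[A] K := Submodule.mkQ _
  let k : K := π (Pi.single 0 1)
  have hker (y : Fin 2 → A) : π y = 0 ↔ lineFunction L X ∣ y 0 :=
    (Submodule.Quotient.mk_eq_zero _).trans mem_range_scaleFirst_iff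
  have hk (y : Fin 2 → A) : y 0 • k = π y := by
    rw [← map_smul, ← sub_eq_zero, ← map_sub, hker]
    simp
  have hspan : Submodule.span A {k} = ⊤ := Submodule.eq_top_iff'.2 fun x => by
    obtain ⟨y, rfl⟩ := Submodule.mkQ_surjective _ x
    exact Submodule.mem_span_singleton.2 ⟨_, hk y⟩
  have hφk : (subMotiveHom hγ).cokerSemilinearTau k = k := by
    refine (congrArg π (semilinearTau_pairMotive _ hγ _)).trans ?_
    rw [pairTau_single_zero, ← hk]
    exact one_smul A k
  have htk : lineFunction L (X : Fq[X]) • k = 0 := by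
    rw [← map_smul, hker]
    exact ⟨1, rfl⟩
  rw [MotiveHom.cokerTau_eq_lift]
  refine Pullback.lift_bijective_of_cyclic hspan (by rwa [hφk]) fun a ha => ?_
  rw [hφk, ← map_smul, hker] at ha
  obtain ⟨w, hw⟩ : lineFunction L X ∣ a := by simpa using ha
  rw [hw, mul_comm, mul_smul, ← sigma_lineFunction, ← map_smulₛₗ, htk, map_zero, smul_zero]

theorem pow_card_add_mul_pow_card_ne_zero (hγ : ∀ x : L, x ^ Fintype.card Fq ≠ γ) (a : L) {b : L}
    (hb : b ≠ 0) : a ^ Fintype.card Fq + γ * b ^ Fintype.card Fq ≠ 0 := by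
  intro h
  have hneg : (-(a / b)) ^ Fintype.card Fq = -(a / b) ^ Fintype.card Fq :=
    map_neg (FiniteField.frobeniusAlgHom Fq L) (a / b)
  refine hγ (-(a / b)) ?_
  rw [hneg, div_pow, neg_eq_iff_eq_neg, div_eq_iff (pow_ne_zero _ hb)]
  linear_combination h

theorem evalCharacteristic_apply_one_eq_zero (hγ : ∀ x : L, x ^ Fintype.card Fq ≠ γ)
    {g : (Fin 2 → (inftyPoint Fq).coordRing L) →ₗ[(inftyPoint Fq).coordRing L]
      (Fin 2 → (inftyPoint Fq).coordRing L)}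
    (hg : ∀ x, g (pairTau 1 X γ x) = pairTau X 1 γ (g x))
    (y : Fin 2 → (inftyPoint Fq).coordRing L) :
    evalCharacteristic (zeroCharacteristic Fq L) (g y 1) = 0 := by
  let ε := evalCharacteristic (zeroCharacteristic Fq L)
  let e₁ : Fin 2 → (inftyPoint Fq).coordRing L := Pi.single 0 1
  let e₂ : Fin 2 → (inftyPoint Fq).coordRing L := Pi.single 1 1
  have ht : ε (lineFunction L (X : Fq[X])) = 0 := by
    rw [evalCharacteristic_lineFunction, coeff_X_zero, map_zero]
  have hτ₁ : pairTau 1 X γ e₁ = e₁ + e₂ := by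
    rw [pairTau_single_zero, map_one]
    ext i
    fin_cases i <;> simp [e₁, e₂]
  have hτ₂ : pairTau 1 X γ e₂ = (lineFunction L (X : Fq[X]) * algebraMap L _ γ) • e₁ := by
    rw [pairTau_single_one]
    ext i
    fin_cases i <;> simp [e₁]
  have hε₂ : ε (g e₂ 1) = 0 := by
    have h := congrArg ε (congrFun (hg e₂) 0)
    rw [hτ₂, map_smul, pairTau_apply, Pi.smul_apply, smul_eq_mul, map_mul, map_mul, ht, zero_mul,
      zero_mul, Matrix.cons_val_zero, map_one, one_mul, map_add, map_mul,
      evalCharacteristic_sigma zeroCharacteristic_pow_card,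
      evalCharacteristic_sigma zeroCharacteristic_pow_card, evalCharacteristic_algebraMap] at h
    exact of_not_not fun hb => pow_card_add_mul_pow_card_ne_zero hγ _ hb h.symm
  have hε₁ : ε (g e₁ 1) = 0 := by
    have h := congrArg ε (congrFun (hg e₁) 1)
    rw [hτ₁, map_add, pairTau_apply, Pi.add_apply, map_add, hε₂, add_zero, Matrix.cons_val_one,
      Matrix.cons_val_zero, map_mul, ht, zero_mul] at h
    exact h
  have hy : y = y 0 • e₁ + y 1 • e₂ := by
    ext i
    fin_cases i <;> simp [e₁, e₂]
  rw [hy, map_add, map_smul, map_smul, Pi.add_apply, Pi.smul_apply, Pi.smul_apply, smul_eq_mul,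
    smul_eq_mul, map_add, map_mul, map_mul, hε₁, hε₂, mul_zero, mul_zero, add_zero]

theorem not_separablyIsogenous_superMotive_subMotive (hγ : γ ≠ 0)
    (hγpow : ∀ x : L, x ^ Fintype.card Fq ≠ γ) :
    ¬ SeparablyIsogenous (superMotive (Fq := Fq) hγ) (subMotive hγ) := by
  rintro ⟨h, -, -, hsurj⟩
  let A := (inftyPoint Fq).coordRing L
  let g : (Fin 2 → A) →ₗ[A] (Fin 2 → A) := h.hom
  have hg (x : Fin 2 → A) : g (pairTau 1 X γ x) = pairTau X 1 γ (g x) :=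
    ((congrArg g (semilinearTau_pairMotive _ hγ x)).symm.trans (h.hom_semilinearTau x)).trans
      (semilinearTau_pairMotive _ hγ _)
  let W : Submodule A (Fin 2 → A) := Submodule.comap (LinearMap.proj 1)
    (RingHom.ker (evalCharacteristic (zeroCharacteristic Fq L)))
  have hgW : LinearMap.range g ≤ W := by
    rintro _ ⟨y, rfl⟩
    exact evalCharacteristic_apply_one_eq_zero hγpow hg y
  have hτW : LinearMap.range (Pullback.lift (pairTau (X : Fq[X]) 1 γ)) ≤ W := by
    rw [range_lift_pairTau (mul_one X) hγ]
    intro x hx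
    have h := (mem_charIdeal_iff _).1 hx
    rwa [pairForm_apply, map_sub, map_mul, evalCharacteristic_lineFunction, coeff_X_zero, map_zero,
      zero_mul, sub_zero] at h
  have htop : (⊤ : Submodule A (Fin 2 → A)) ≤ W :=
    (MotiveHom.range_sup_range_eq_top hsurj).ge.trans (sup_le hgW hτW)
  have hone : evalCharacteristic (zeroCharacteristic Fq L) 1 = 0 :=
    htop (Submodule.mem_top (x := fun _ => 1))
  exact one_ne_zero ((map_one _).symm.trans hone)

end Asymmetry

end

theorem mainTheorem5_general :
    (∀ (Fq Q L : Type u) [Field Fq] [Fintype Fq] [Field Q] [Algebra Fq Q] [Field L] [Algebra Fq L]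
      [Finite L], IsCurveFunctionField Fq Q →
      ∀ (P : RationalPoint Fq Q) (c : P.affineRing →ₐ[Fq] L),
        Equivalence (SeparablyIsogenous : PureAndersonMotive P c → PureAndersonMotive P c → Prop)) ∧
    (∀ (Fq L : Type u) [Field Fq] [Fintype Fq] [Field L] [Algebra Fq L] (γ : L),
      (∀ x : L, x ^ Fintype.card Fq ≠ γ) →
      ∃ (P : RationalPoint Fq (RatFunc Fq)) (c : P.affineRing →ₐ[Fq] L),
        (RatFunc.X : RatFunc Fq) ∉ P.valuationRing ∧
        (∀ a : P.affineRing, (a : RatFunc Fq) = RatFunc.X → c a = 0) ∧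
        ∃ X Y : PureAndersonMotive P c, SeparablyIsogenous X Y ∧ ¬ SeparablyIsogenous Y X) := by
  refine ⟨fun _ _ _ _ _ _ _ _ _ _ hC _ _ => SeparablyIsogenous.equivalence hC, ?_⟩
  intro Fq L _ _ _ _ γ hγpow
  have hγ : γ ≠ 0 := fun h => hγpow 0 (by rw [h, zero_pow Fintype.card_ne_zero])
  refine ⟨inftyPoint Fq, zeroCharacteristic Fq L, X_notMem_inftyValuationRing, fun a ha => ?_,
    subMotive hγ, superMotive hγ, ⟨_, isSeparableIsogeny_subMotiveHom hγ⟩,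
    not_separablyIsogenous_superMotive_subMotive hγ hγpow⟩
  have haX : a = affineRingEquiv Fq Polynomial.X := Subtype.val_injective (by
    rw [ha, coe_affineRingEquiv, RatFunc.algebraMap_X])
  rw [haX, zeroCharacteristic_affineRingEquiv, Polynomial.coeff_X_zero, map_zero]

theorem mainTheorem5 :
    (∀ (Fq Q L : Type u) [Field Fq] [Fintype Fq] [Field Q] [Algebra Fq Q] [Field L] [Algebra Fq L]
      [Finite L], IsCurveFunctionField Fq Q →
      ∀ (P : RationalPoint Fq Q) (c : P.affineRing →ₐ[Fq] L),
        Equivalence (SeparablyIsogenous : PureAndersonMotive P c → PureAndersonMotive P c → Prop)) ∧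
    (∀ (Fq : Type u) [Field Fq] [Fintype Fq],
      ∃ (P : RationalPoint Fq (RatFunc Fq)) (c : P.affineRing →ₐ[Fq] RatFunc Fq),
        (RatFunc.X : RatFunc Fq) ∉ P.valuationRing ∧
        (∀ a : P.affineRing, (a : RatFunc Fq) = RatFunc.X → c a = 0) ∧
        ∃ X Y : PureAndersonMotive P c, SeparablyIsogenous X Y ∧ ¬ SeparablyIsogenous Y X) :=
  ⟨mainTheorem5_general.1, fun Fq _ _ => mainTheorem5_general.2 Fq (RatFunc Fq) RatFunc.X fun x =>
    RatFunc.algebraMap_X (K := Fq) ▸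
      pow_ne_algebraMap_of_irreducible Polynomial.irreducible_X Fintype.one_lt_card x⟩
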